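/- Let $\Omega\subset\mathbb{R}^2$ be a bounded open set that is strictly convex (that is, $\Omega$ is convex and $\partial\Omega$ contains no nondegenerate line segment). Let $g:\partial\Omega\to\mathbb{R}$ be nonconstant and continuous, and suppose that for every $c\in\mathbb{R}$ the level set $g^{-1}(c)$ has only finitely many endpoints, i.e. only finitely many boundary points relative to $\partial\Omega$. Then there is at least one continuous function $u:\overline{\Omega}\to\mathbb{R}$ with the following properties. 1. $u=g$ on $\partial\Omega$. 2. $u$ has the local median value property: there is a continuous function $R:\Omega\to\mathbb{R}$ with $0<R(x)\le\operatorname{dist}(x,\partial\Omega)$ such that for all $x\in\Omega$ and all $0<r\le R(x)$ the value $u(x)$ is the median of $u$ over the circle $\partial B(x,r)$ with respect to arc length $\mathcal{H}^1$, i.e. each of the sets $\{s\in\partial B(x,r):u(s)\ge u(x)\}$ and $\{s\in\partial B(x,r):u(s)\le u(x)\}$ has arc length at least $\tfrac12\mathcal{H}^1(\partial B(x,r))$. 3. Every connected component of every level set $\{x\in\Omega:u(x)=c\}$ is either a chord of $\Omega$ (the open segment between two distinct points of $\partial\Omega$) or a generalized polygon, i.e. a relatively closed convex subset of $\Omega$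 with nonempty interior whose boundary in $\Omega$ is the union of a finite, nonempty family of chords of $\Omega$ (its remaining edges, if any, are arcs of $\partial\Omega$). -/

import Mathlib

open Set MeasureTheory

/-- `m` is a median of `f` over `E` with respect to the measure `μ`:
`μ {x ∈ E | f x ≥ m} ≥ μ E / 2` and `μ {x ∈ E | f x ≤ m} ≥ μ E / 2`. -/
def IsMedianOver {α : Type*} [MeasurableSpace α] (μ : Measure α) (E : Set α) (f : α → ℝ)
    (m : ℝ) : Prop :=
  μ E / 2 ≤ μ {x ∈ E | m ≤ f x} ∧ μ E / 2 ≤ μ {x ∈ E | f x ≤ m}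

/-- The local median value property of a function `u` on a planar domain `Ω`: there is a continuous
radius `R : Ω → ℝ` with `0 < R x ≤ dist (x, ∂Ω)` such that, for all `x ∈ Ω` and all
`0 < r ≤ R x`, the value `u x` is a median of `u` over the circle `∂B(x, r)` with respect to arc
length (one-dimensional Hausdorff measure). For continuous `u` such a median is unique.
All the circles lie in `closure Ω`. -/
def HasLocalMedianValueProperty (Ω : Set (EuclideanSpace ℝ (Fin 2)))
    (u : EuclideanSpace ℝ (Fin 2) → ℝ) : Prop :=
  ∃ R : EuclideanSpace ℝ (Fin 2) → ℝ, ContinuousOn R Ω ∧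
    (∀ x ∈ Ω, 0 < R x ∧ R x ≤ Metric.infDist x (frontier Ω)) ∧
    ∀ x ∈ Ω, ∀ r : ℝ, 0 < r → r ≤ R x →
      IsMedianOver (Measure.hausdorffMeasure 1) (Metric.sphere x r) u (u x)

/-- `K` is a chord of `Ω` (without its endpoints): the open segment between two distinct points
of `∂Ω`. -/
def IsOpenChord (Ω K : Set (EuclideanSpace ℝ (Fin 2))) : Prop :=
  ∃ p ∈ frontier Ω, ∃ q ∈ frontier Ω, p ≠ q ∧ K = openSegment ℝ p q

/-- `K` is the part in `Ω` of a generalized polygon with vertices on `∂Ω`, whose edges are chords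
of `Ω` and possibly arcs of `∂Ω`: a relatively closed convex subset of `Ω` with nonempty interior,
whose boundary in `Ω` is the union of a finite, nonempty family of chords of `Ω`. -/
def IsGeneralizedPolygon (Ω K : Set (EuclideanSpace ℝ (Fin 2))) : Prop :=
  K ⊆ Ω ∧ Ω ∩ closure K ⊆ K ∧ Convex ℝ K ∧ (interior K).Nonempty ∧
    ∃ E : Set (Set (EuclideanSpace ℝ (Fin 2))), E.Finite ∧ E.Nonempty ∧
      (∀ e ∈ E, IsOpenChord Ω e) ∧ Ω ∩ frontier K = ⋃₀ E

open Filter Topology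

/-! Fix `c₀` strictly between two values of `g`. The function `u` is built from its level sets: for
`c ≥ c₀` the set `{u ≤ c}` is the convex hull of `{g ≤ c}`, and for `c ≤ c₀` the set `{u ≥ c}` is
the convex hull of `{g ≥ c}`. `clampedEnvelope` does both, being the median of `c₀` and the
quasiconvex and quasiconcave envelopes. By strict convexity every boundary point is exposed, so
hulls acquire no new boundary points (hence `u = g`) and hulls of relatively open boundary sets are
relatively open (hence continuity).

Median property: let `c = u x`. If `c > c₀`, then `{u < c}` is convex and, in `Ω`, open, and a line
through `x` missing it leaves half of each small circle in `{u ≥ c}`. The crux is the other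
inequality, as `x` may lie on the boundary of the hull `{u ≤ c}`. A hull of points of `∂Ω` has no
corners inside `Ω`, so it contains half of a small circle; `exists_halfCircle_subset` makes this
quantitative. All hulls with `c ≥ c₀` share a disc, which yields a radius proportional to the
distance to `∂Ω`. The case `c < c₀` follows by passing to `-u`.

Level sets: at `c₀` the level set is an intersection of two hulls, hence connected (`middle_level`).
For `c > c₀` it is a difference of hulls, and a single chord cuts each component off from the hull
of `{g < c}` (`upper_level`). The boundary in `Ω` consists of chords between endpoints of a level
set of `g`, which are finitely many. -/

abbrev Plane : Type := EuclideanSpace ℝ (Fin 2)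

/-! ### Convex hulls: compactness, faces, and bounds on linear forms. -/

section ConvexHull

variable {V : Type*} [NormedAddCommGroup V] [NormedSpace ℝ V]

/-- A simplex is the join of a vertex with the opposite face, so each induction step takes the image
of a compact set `[0,1] × F × A`. With Carathéodory's theorem, this makes hulls of compact sets
compact. -/
theorem exists_isCompact_convexHull_finset_subset {F : Set V} (hF : IsCompact F) (n : ℕ) :
    ∃ A : Set V, IsCompact A ∧ A ⊆ convexHull ℝ F ∧
      ∀ t : Finset V, (t : Set V) ⊆ F → t.card ≤ n → convexHull ℝ (t : Set V) ⊆ A := by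
  classical
  induction n with
  | zero =>
    refine ⟨∅, isCompact_empty, empty_subset _, fun t _ ht => ?_⟩
    have : t = ∅ := by simpa using ht
    simp [this]
  | succ n ih =>
    obtain ⟨A, hAc, hAF, hA⟩ := ih
    let f : ℝ × V × V → V := fun z => (1 - z.1) • z.2.1 + z.1 • z.2.2
    have hf : Continuous f := by fun_prop
    refine ⟨F ∪ f '' (Icc 0 1 ×ˢ F ×ˢ A), hF.union ((isCompact_Icc.prod (hF.prod hAc)).image hf),
      union_subset (subset_convexHull ℝ F) ?_, fun t htF ht => ?_⟩
    · rintro _ ⟨⟨s, p, a⟩, ⟨hs, hp, ha⟩, rfl⟩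
      exact convex_convexHull ℝ F (subset_convexHull ℝ F hp) (hAF ha) (by linarith [hs.2]) hs.1
        (by ring)
    · rcases t.eq_empty_or_nonempty with rfl | ⟨p, hp⟩
      · simp
      have hpF : p ∈ F := htF (by simpa using hp)
      rw [← Finset.insert_erase hp, Finset.coe_insert]
      rcases (t.erase p).eq_empty_or_nonempty with he | he
      · simp [he, hpF]
      rw [convexHull_insert (Finset.coe_nonempty.2 he)]
      intro x hx
      obtain ⟨_, hq, b, hb, hxb⟩ := mem_convexJoin.1 hx
      obtain rfl := mem_singleton_iff.1 hq
      have hbA : b ∈ A := by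
        refine hA (t.erase _) (fun z hz => htF ?_) ?_ hb
        · exact_mod_cast Finset.mem_of_mem_erase (by exact_mod_cast hz)
        · rw [Finset.card_erase_of_mem hp]; omega
      rw [segment_eq_image] at hxb
      obtain ⟨r, hr, rfl⟩ := hxb
      refine Or.inr ⟨(r, _, b), ⟨hr, hpF, hbA⟩, rfl⟩

theorem IsCompact.convexHull_of_finiteDimensional [FiniteDimensional ℝ V] {F : Set V}
    (hF : IsCompact F) : IsCompact (convexHull ℝ F) := by
  obtain ⟨A, hAc, hAF, hA⟩ :=
    exists_isCompact_convexHull_finset_subset hF (Module.finrank ℝ V + 1)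
  convert hAc
  refine subset_antisymm (fun x hx => ?_) hAF
  rw [convexHull_eq_union] at hx
  simp only [mem_iUnion] at hx
  obtain ⟨t, htF, hti, hx⟩ := hx
  refine hA t htF ?_ hx
  have := hti.card_le_finrank_succ
  simp only [Fintype.card_coe] at this
  refine this.trans (Nat.succ_le_succ (Submodule.finrank_le _))

/-- A face of a convex hull is the convex hull of the generators on it. -/
theorem mem_convexHull_inter_of_le {F : Set V} {m : V →L[ℝ] ℝ} {y : V}
    (hF : ∀ p ∈ F, m p ≤ m y) (hy : y ∈ convexHull ℝ F) :
    y ∈ convexHull ℝ (F ∩ {p | m p = m y}) := by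
  have key : convexHull ℝ F ⊆
      {z | m z ≤ m y ∧ (m z = m y → z ∈ convexHull ℝ (F ∩ {p | m p = m y}))} := by
    refine convexHull_min (fun p hp => ⟨hF p hp, fun h => subset_convexHull ℝ _ ⟨hp, h⟩⟩) ?_
    rintro a ⟨ha, ha'⟩ b ⟨hb, hb'⟩ s t hs ht hst
    simp only [mem_ofPred_eq, map_add, map_smul, smul_eq_mul]
    have e : m y = s * m y + t * m y := by rw [← add_mul, hst, one_mul]
    refine ⟨?_, fun h => ?_⟩
    · rw [e]; gcongr
    · rcases hs.eq_or_lt with rfl | hs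
      · obtain rfl : t = 1 := by linarith
        simp only [zero_smul, one_smul, zero_add]
        exact hb' (by linarith)
      rcases ht.eq_or_lt with rfl | ht
      · obtain rfl : s = 1 := by linarith
        simp only [zero_smul, one_smul, add_zero]
        exact ha' (by linarith)
      have h1 : s * m a ≤ s * m y := by gcongr
      have h2 : t * m b ≤ t * m y := by gcongr
      have h3 : s * m a = s * m y := by linarith
      have h4 : t * m b = t * m y := by linarith
      exact convex_convexHull ℝ _ (ha' (mul_left_cancel₀ hs.ne' h3))
        (hb' (mul_left_cancel₀ ht.ne' h4)) hs.le ht.le hst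
  exact (key hy).2 rfl

theorem le_of_mem_convexHull {F : Set V} {m : V →L[ℝ] ℝ} {s : ℝ} (hF : ∀ p ∈ F, m p ≤ s) {y : V}
    (hy : y ∈ convexHull ℝ F) : m y ≤ s :=
  convexHull_min (t := {z | m z ≤ s}) hF (convex_halfSpace_le m.toLinearMap.isLinear s) hy

theorem lt_of_mem_convexHull {F : Set V} {m : V →L[ℝ] ℝ} {s : ℝ} (hF : ∀ p ∈ F, m p < s) {y : V}
    (hy : y ∈ convexHull ℝ F) : m y < s :=
  convexHull_min (t := {z | m z < s}) hF (convex_halfSpace_lt m.toLinearMap.isLinear s) hy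

theorem exists_apply_le_of_mem_convexHull {F : Set V} (m : V →L[ℝ] ℝ) {y : V}
    (hy : y ∈ convexHull ℝ F) : ∃ p ∈ F, m y ≤ m p := by
  by_contra! h
  exact lt_irrefl _ (lt_of_mem_convexHull h hy)

end ConvexHull

theorem IsPreconnected.exists_mem_frontier {X : Type*} [TopologicalSpace X] {S T : Set X}
    (hS : IsPreconnected S) {a b : X} (ha : a ∈ S) (haT : a ∈ T) (hb : b ∈ S) (hbT : b ∉ T) :
    ∃ x ∈ S, x ∈ frontier T := by
  by_contra! h
  have h' : ∀ x ∈ S, x ∈ T → x ∈ interior T := fun x hx hxT => by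
    by_contra hi
    exact h x hx ⟨subset_closure hxT, hi⟩
  have h2 : ∀ x ∈ S, x ∉ T → x ∈ (closure T)ᶜ := fun x hx hxT hc =>
    h x hx ⟨hc, fun hi => hxT (interior_subset hi)⟩
  obtain ⟨x, -, hx1, hx2⟩ := hS (interior T) (closure T)ᶜ isOpen_interior
    isClosed_closure.isOpen_compl
    (fun x hx => by
      by_cases hxT : x ∈ T
      · exact Or.inl (h' x hx hxT)
      · exact Or.inr (h2 x hx hxT))
    ⟨a, ha, h' a ha haT⟩ ⟨b, hb, h2 b hb hbT⟩
  exact hx2 (subset_closure (interior_subset hx1))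

/-! ### Linear forms on the plane. -/

section Plane

/-- The linear form vanishing on `d`, the determinant with `d`. -/
noncomputable def detForm (d : Plane) : Plane →L[ℝ] ℝ :=
  d 0 • EuclideanSpace.proj (1 : Fin 2) - d 1 • EuclideanSpace.proj (0 : Fin 2)

@[simp] theorem detForm_apply (d w : Plane) : detForm d w = d 0 * w 1 - d 1 * w 0 := by
  simp [detForm]

theorem Plane.apply_eq (m : Plane →L[ℝ] ℝ) (w : Plane) :
    m w = w 0 * m (EuclideanSpace.single 0 1) + w 1 * m (EuclideanSpace.single 1 1) := by
  have : w = w 0 • EuclideanSpace.single 0 (1 : ℝ) + w 1 • EuclideanSpace.single 1 (1 : ℝ) := by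
    ext i; fin_cases i <;> simp
  conv_lhs => rw [this]
  simp

theorem Plane.exists_ne_zero_apply_eq_zero (m : Plane →L[ℝ] ℝ) : ∃ d : Plane, d ≠ 0 ∧ m d = 0 := by
  by_cases h0 : m (EuclideanSpace.single 0 1) = 0
  · exact ⟨EuclideanSpace.single 0 1, by simp, h0⟩
  · refine ⟨!₂[-m (EuclideanSpace.single 1 1), m (EuclideanSpace.single 0 1)], fun h => h0 ?_, ?_⟩
    · simpa using congrArg (fun v : Plane => v 1) h
    · rw [Plane.apply_eq m]; simp; ring

theorem Plane.exists_smul_eq {m : Plane →L[ℝ] ℝ} (hm : m ≠ 0) {d w : Plane} (hd : d ≠ 0)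
    (hmd : m d = 0) (hw : m w = 0) : ∃ t : ℝ, w = t • d := by
  rw [Plane.apply_eq] at hmd hw
  set α := m (EuclideanSpace.single 0 1)
  set β := m (EuclideanSpace.single 1 1)
  have hαβ : α ≠ 0 ∨ β ≠ 0 := by
    by_contra! h
    exact hm (ContinuousLinearMap.ext fun v => by
      rw [Plane.apply_eq, zero_apply]
      change v 0 * α + v 1 * β = 0
      rw [h.1, h.2]; ring)
  have hdet : w 0 * d 1 = w 1 * d 0 := by
    rcases hαβ with h | h
    · apply mul_left_cancel₀ h; linear_combination d 1 * hw - w 1 * hmd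
    · apply mul_left_cancel₀ h; linear_combination -d 0 * hw + w 0 * hmd
  by_cases h0 : d 0 = 0
  · have h1 : d 1 ≠ 0 := fun h1 => hd (by ext i; fin_cases i <;> simp [h0, h1])
    refine ⟨w 1 / d 1, ?_⟩
    ext i; fin_cases i
    · simp only [h0, mul_zero, mul_eq_zero, h1, or_false] at hdet
      simp [h0, hdet]
    · simp [h1]
  · refine ⟨w 0 / d 0, ?_⟩
    ext i; fin_cases i
    · simp [h0]
    · simp only [PiLp.smul_apply, smul_eq_mul, Fin.mk_one]
      field_simp
      linarith

end Plane

/-! ### Chords, exposed points and hulls of boundary sets in a strictly convex domain. -/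

/-- A bounded strictly convex planar domain. -/
structure StrictlyConvexDomain (Ω : Set Plane) : Prop where
  isOpen : IsOpen Ω
  isBounded : Bornology.IsBounded Ω
  convex : Convex ℝ Ω
  strict : StrictConvex ℝ (closure Ω)
  nonempty : Ω.Nonempty

namespace StrictlyConvexDomain

variable {Ω : Set Plane} (H : StrictlyConvexDomain Ω)
include H

theorem interior_closure : interior (closure Ω) = Ω := by
  rw [H.convex.interior_closure_eq_interior_of_nonempty_interior
    (by rw [H.isOpen.interior_eq]; exact H.nonempty), H.isOpen.interior_eq]

theorem frontier_eq : frontier Ω = closure Ω \ Ω := H.isOpen.frontier_eq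

theorem notMem_of_mem_frontier {p : Plane} (hp : p ∈ frontier Ω) : p ∉ Ω := by
  rw [H.frontier_eq] at hp; exact hp.2

theorem mem_or_mem_frontier {p : Plane} (hp : p ∈ closure Ω) : p ∈ Ω ∨ p ∈ frontier Ω := by
  rw [H.frontier_eq]; by_cases h : p ∈ Ω
  · exact Or.inl h
  · exact Or.inr ⟨hp, h⟩

theorem isCompact_closure : IsCompact (closure Ω) := H.isBounded.isCompact_closure

theorem isCompact_frontier : IsCompact (frontier Ω) :=
  H.isCompact_closure.of_isClosed_subset isClosed_frontier frontier_subset_closure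

theorem convex_closure : Convex ℝ (closure Ω) := H.convex.closure

theorem convexHull_subset {F : Set Plane} (hF : F ⊆ frontier Ω) :
    convexHull ℝ F ⊆ closure Ω :=
  convexHull_min (hF.trans frontier_subset_closure) H.convex_closure

theorem openSegment_subset {p q : Plane} (hp : p ∈ closure Ω) (hq : q ∈ closure Ω) (hpq : p ≠ q) :
    openSegment ℝ p q ⊆ Ω := by
  have := H.strict.openSegment_subset hp hq hpq
  rwa [H.interior_closure] at this

theorem openSegment_subset_of_mem {p q : Plane} (hp : p ∈ Ω) (hq : q ∈ closure Ω) :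
    openSegment ℝ p q ⊆ Ω := by
  by_cases h : p = q
  · subst h; simpa using hp
  · exact H.openSegment_subset (subset_closure hp) hq h

theorem exists_pos_add_smul_mem_frontier {y d : Plane} (hy : y ∈ Ω) (hd : d ≠ 0) :
    ∃ t : ℝ, 0 < t ∧ y + t • d ∈ frontier Ω := by
  obtain ⟨C, hC⟩ := H.isBounded.exists_norm_le
  have hd' : 0 < ‖d‖ := norm_pos_iff.2 hd
  set T : ℝ := (C + 1 + ‖y‖) / ‖d‖
  have hCy := hC y hy
  have hT : 0 ≤ T := div_nonneg (by linarith [norm_nonneg y]) hd'.le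
  have hout : y + T • d ∉ Ω := fun h => by
    have h1 := hC _ h
    have h2 : ‖T • d‖ ≤ ‖y + T • d‖ + ‖y‖ := by
      have := norm_sub_le (y + T • d) y
      simpa using this
    rw [norm_smul, Real.norm_of_nonneg hT, div_mul_cancel₀ _ hd'.ne'] at h2
    linarith
  obtain ⟨x, ⟨t, ht, rfl⟩, hx⟩ := ((isPreconnected_Icc (a := (0 : ℝ)) (b := T)).image
    (fun t => y + t • d) (by fun_prop)).exists_mem_frontier (T := Ω)
    (mem_image_of_mem _ (left_mem_Icc.2 hT)) (by simpa using hy)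
    (mem_image_of_mem _ (right_mem_Icc.2 hT)) hout
  refine ⟨t, lt_of_le_of_ne ht.1 fun h => H.notMem_of_mem_frontier hx ?_, hx⟩
  simpa [← h] using hy

/-- A line through `y` on which `m` is constant leaves `Ω` on both sides of `y`, and `y` lies
between the two exit points. The case `m = 0` is allowed. -/
theorem mem_convexHull_slice {y : Plane} (hy : y ∈ closure Ω) (m : Plane →L[ℝ] ℝ) :
    y ∈ convexHull ℝ (frontier Ω ∩ {p | m p = m y}) := by
  rcases H.mem_or_mem_frontier hy with hy | hy
  · obtain ⟨d, hd, hmd⟩ := Plane.exists_ne_zero_apply_eq_zero m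
    obtain ⟨t, ht, htf⟩ := H.exists_pos_add_smul_mem_frontier hy hd
    obtain ⟨s, hs, hsf⟩ := H.exists_pos_add_smul_mem_frontier hy (neg_ne_zero.2 hd)
    have h1 := subset_convexHull ℝ (frontier Ω ∩ {p | m p = m y}) ⟨htf, by simp [hmd]⟩
    have h2 := subset_convexHull ℝ (frontier Ω ∩ {p | m p = m y}) ⟨hsf, by simp [hmd]⟩
    have h3 := convex_convexHull ℝ (frontier Ω ∩ {p | m p = m y}) h1 h2 (a := s / (s + t))
      (b := t / (s + t)) (by positivity) (by positivity) (by field_simp)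
    convert h3 using 1
    have h4 : s / (s + t) + t / (s + t) = 1 := by field_simp
    have h5 : s / (s + t) * t - t / (s + t) * s = 0 := by field_simp; ring
    calc y = (s / (s + t) + t / (s + t)) • y + (s / (s + t) * t - t / (s + t) * s) • d := by
          rw [h4, h5]; simp
      _ = _ := by module
  · exact subset_convexHull ℝ _ ⟨hy, rfl⟩

theorem mem_convexHull_frontier {y : Plane} (hy : y ∈ closure Ω) :
    y ∈ convexHull ℝ (frontier Ω) :=
  convexHull_mono inter_subset_left (H.mem_convexHull_slice hy 0)

/-- Every boundary point is exposed. -/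
theorem exists_strict_support {p : Plane} (hp : p ∈ frontier Ω) :
    ∃ m : Plane →L[ℝ] ℝ, ∀ y ∈ closure Ω, y ≠ p → m y < m p := by
  obtain ⟨m, hm⟩ := geometric_hahn_banach_open_point H.convex H.isOpen
    (H.notMem_of_mem_frontier hp)
  have hle : ∀ y ∈ closure Ω, m y ≤ m p := fun y hy =>
    closure_minimal (fun z hz => (hm z hz).le) (isClosed_le m.continuous continuous_const) hy
  refine ⟨m, fun y hy hyp => (hle y hy).lt_of_ne fun h => ?_⟩
  have := hm _ (H.openSegment_subset hy (frontier_subset_closure hp) hyp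
    (show (1 / 2 : ℝ) • y + (1 / 2 : ℝ) • p ∈ _ from
      ⟨1 / 2, 1 / 2, by norm_num, by norm_num, by norm_num, rfl⟩))
  simp only [map_add, map_smul, smul_eq_mul, h] at this
  linarith

theorem mem_of_mem_convexHull {p : Plane} (hp : p ∈ frontier Ω) {F : Set Plane}
    (hF : F ⊆ frontier Ω) (h : p ∈ convexHull ℝ F) : p ∈ F := by
  obtain ⟨m, hm⟩ := H.exists_strict_support hp
  obtain ⟨q, hq, hpq⟩ := exists_apply_le_of_mem_convexHull m h
  by_cases hqp : q = p
  · rwa [← hqp]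
  · exact absurd (hm q (frontier_subset_closure (hF hq)) hqp) (not_lt.2 hpq)

/-- Since `p` is exposed, the caps `{m > t}` shrink to `p`. A point of a small cap lies in the hull
of its slice, whose boundary points belong to the same cap and hence to `N`. -/
theorem convexHull_mem_nhdsWithin {p : Plane} (hp : p ∈ frontier Ω) {N : Set Plane}
    (hN : N ∈ 𝓝[frontier Ω] p) : convexHull ℝ (N ∩ frontier Ω) ∈ 𝓝[closure Ω] p := by
  obtain ⟨m, hm⟩ := H.exists_strict_support hp
  obtain ⟨O, hO, hpO, hON⟩ := mem_nhdsWithin.1 hN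
  have hcpt : IsCompact (closure Ω \ O) := H.isCompact_closure.diff hO
  obtain ⟨t, htp, ht⟩ : ∃ t, t < m p ∧ ∀ y ∈ closure Ω, t < m y → y ∈ O := by
    rcases (closure Ω \ O).eq_empty_or_nonempty with he | hne
    · refine ⟨m p - 1, by linarith, fun y hy _ => ?_⟩
      by_contra hyO
      exact (he ▸ (⟨hy, hyO⟩ : y ∈ closure Ω \ O) : y ∈ (∅ : Set Plane))
    · obtain ⟨z, hz, hzmax⟩ := hcpt.exists_isMaxOn hne m.continuous.continuousOn
      refine ⟨m z, hm z hz.1 fun h => hz.2 (h ▸ hpO), fun y hy hty => ?_⟩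
      by_contra hyO
      exact absurd (hzmax ⟨hy, hyO⟩) (not_le.2 hty)
  refine mem_nhdsWithin.2 ⟨{y | t < m y}, isOpen_lt continuous_const m.continuous, htp, ?_⟩
  rintro y ⟨hty, hy⟩
  refine convexHull_mono ?_ (H.mem_convexHull_slice hy m)
  rintro q ⟨hq, hqy⟩
  have hqy : m q = m y := hqy
  exact ⟨hON ⟨ht q (frontier_subset_closure hq) (by rw [hqy]; exact hty), hq⟩, hq⟩

theorem exists_apply_gt {w : Plane} (hw : w ∈ Ω) {m : Plane →L[ℝ] ℝ} (hm : m ≠ 0) :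
    ∃ y ∈ Ω, m w < m y := by
  by_contra! h
  have hmax : IsLocalMax m w := Filter.eventually_of_mem (H.isOpen.mem_nhds hw) h
  exact hm (by simpa using hmax.hasFDerivAt_eq_zero m.hasFDerivAt)

/-- A line meeting `Ω` crosses the boundary: otherwise `closure Ω` near `p` would lie in `{m ≤ m
w}`, but moving from `p` towards a point of `Ω` with larger `m` leaves this half-plane. -/
theorem frequently_apply_gt {w p : Plane} (hw : w ∈ Ω) (hp : p ∈ frontier Ω) {m : Plane →L[ℝ] ℝ}
    (hm : m ≠ 0) (hpw : m p = m w) : ∃ᶠ q in 𝓝[frontier Ω] p, m w < m q := by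
  intro hcon
  have h1 := H.convexHull_mem_nhdsWithin hp hcon
  have h2 : ∀ᶠ y in 𝓝[closure Ω] p, m y ≤ m w :=
    mem_of_superset h1 fun y hy => le_of_mem_convexHull (fun q hq => not_lt.1 hq.1) hy
  obtain ⟨x, hx, hwx⟩ := H.exists_apply_gt hw hm
  have hlim : Tendsto (fun ε : ℝ => p + ε • (x - p)) (𝓝[>] 0) (𝓝[closure Ω] p) := by
    refine tendsto_nhdsWithin_iff.2 ⟨?_, ?_⟩
    · have : Continuous fun ε : ℝ => p + ε • (x - p) := by fun_prop
      simpa using (this.tendsto 0).mono_left nhdsWithin_le_nhds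
    · filter_upwards [Ioo_mem_nhdsGT (zero_lt_one' ℝ)] with ε hε
      exact H.convex_closure.add_smul_sub_mem (frontier_subset_closure hp) (subset_closure hx)
        ⟨hε.1.le, hε.2.le⟩
  obtain ⟨ε, hε, hε0⟩ := ((hlim.eventually h2).and self_mem_nhdsWithin).exists
  have hε0 : 0 < ε := hε0
  simp only [map_add, map_smul, map_sub, smul_eq_mul, hpw] at hε
  nlinarith

/-- A line through a point `y` of the domain meets the boundary in two points; if `y` is a convex
combination of boundary points on this line, then these are the two points. -/
theorem exists_chord {y : Plane} (hy : y ∈ Ω) {m : Plane →L[ℝ] ℝ} (hm : m ≠ 0) {F : Set Plane}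
    (hF : F ⊆ frontier Ω) (hyF : y ∈ convexHull ℝ (F ∩ {p | m p = m y})) :
    ∃ p ∈ F, ∃ q ∈ F, p ≠ q ∧ m p = m y ∧ m q = m y ∧ y ∈ openSegment ℝ p q ∧
      ∀ x ∈ frontier Ω, m x = m y → x = p ∨ x = q := by
  obtain ⟨d, hd, hmd⟩ := Plane.exists_ne_zero_apply_eq_zero m
  have hline : ∀ x ∈ frontier Ω, m x = m y → ∃ t : ℝ, t ≠ 0 ∧ x = y + t • d := by
    intro x hx hxy
    obtain ⟨t, ht⟩ := Plane.exists_smul_eq hm hd hmd (w := x - y) (by simp [hxy])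
    refine ⟨t, ?_, by rw [← ht]; abel⟩
    rintro rfl
    refine H.notMem_of_mem_frontier hx ?_
    rw [zero_smul, sub_eq_zero] at ht
    rwa [ht]
  have hord : ∀ s t : ℝ, y + s • d ∈ frontier Ω → y + t • d ∈ frontier Ω → 0 < s * t →
      |s| < |t| → False := by
    intro s t hs ht hst hlt
    refine H.notMem_of_mem_frontier hs
      (H.openSegment_subset_of_mem hy (frontier_subset_closure ht) ?_)
    have ht0 : t ≠ 0 := by rintro rfl; simp at hst
    have hr : 0 < s / t := by
      rw [show s / t = s * t / t ^ 2 by field_simp]; positivity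
    have hr1 : s / t < 1 := by
      rw [← abs_of_pos hr, abs_div]
      exact (div_lt_one (abs_pos.2 ht0)).2 hlt
    refine ⟨1 - s / t, s / t, by linarith, hr, by ring, ?_⟩
    have : s / t * t = s := by field_simp
    calc _ = y + (s / t * t) • d := by module
      _ = _ := by rw [this]
  have huniq : ∀ s t : ℝ, y + s • d ∈ frontier Ω → y + t • d ∈ frontier Ω → 0 < s * t → s = t := by
    intro s t hs ht hst
    rcases lt_trichotomy |s| |t| with h | h | h
    · exact (hord s t hs ht hst h).elim
    · rcases abs_eq_abs.1 h with h | h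
      · exact h
      · subst h; nlinarith [sq_nonneg t]
    · exact (hord t s ht hs (by linarith) h).elim
  obtain ⟨e, he⟩ : ∃ e : Plane →L[ℝ] ℝ, 0 < e d := by
    refine ⟨innerSL ℝ d, ?_⟩
    rw [innerSL_apply_apply]
    exact real_inner_self_pos.2 hd
  obtain ⟨p, ⟨hpF, hpm⟩, hpe⟩ := exists_apply_le_of_mem_convexHull e hyF
  obtain ⟨q, ⟨hqF, hqm⟩, hqe⟩ := exists_apply_le_of_mem_convexHull (-e) hyF
  obtain ⟨s, hs, rfl⟩ := hline p (hF hpF) hpm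
  obtain ⟨t, ht, rfl⟩ := hline q (hF hqF) hqm
  simp only [map_add, map_smul, smul_eq_mul, neg_apply] at hpe hqe
  have hs : 0 < s := lt_of_le_of_ne (by nlinarith) hs.symm
  have ht : t < 0 := lt_of_le_of_ne (by nlinarith) ht
  have hst : s - t ≠ 0 := by linarith
  refine ⟨_, hpF, _, hqF, ?_, hpm, hqm, ⟨-t / (s - t), s / (s - t), ?_, ?_, ?_, ?_⟩, ?_⟩
  · intro h
    rw [add_right_inj, ← sub_eq_zero, ← sub_smul, smul_eq_zero] at h
    exact h.elim hst hd
  · exact div_pos (by linarith) (by linarith)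
  · exact div_pos hs (by linarith)
  · field_simp; ring
  · have h4 : -t / (s - t) + s / (s - t) = 1 := by field_simp; ring
    have h5 : -t / (s - t) * s + s / (s - t) * t = 0 := by field_simp; ring
    calc _ = (-t / (s - t) + s / (s - t)) • y + (-t / (s - t) * s + s / (s - t) * t) • d := by
          module
      _ = y := by rw [h4, h5]; simp
  · intro x hx hxy
    obtain ⟨r, hr, rfl⟩ := hline x hx hxy
    rcases lt_or_gt_of_ne hr with h | h
    · exact Or.inr (by rw [huniq r t hx (hF hqF) (mul_pos_of_neg_of_neg h ht)])
    · exact Or.inl (by rw [huniq r s hx (hF hpF) (mul_pos h hs)])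

theorem isClosed_convexHull {F : Set Plane} (hF : F ⊆ frontier Ω) (hFc : IsClosed F) :
    IsClosed (convexHull ℝ F) :=
  (H.isCompact_frontier.of_isClosed_subset hFc hF).convexHull_of_finiteDimensional.isClosed

/-- The parallel through `x` to a line separating `x` from the hull of `F` meets the boundary only
outside `F`. -/
theorem mem_convexHull_diff {F : Set Plane} (hF : F ⊆ frontier Ω) (hFc : IsClosed F) {x : Plane}
    (hx : x ∈ closure Ω) (hxF : x ∉ convexHull ℝ F) : x ∈ convexHull ℝ (frontier Ω \ F) := by
  obtain ⟨m, s, hm, hs⟩ := geometric_hahn_banach_closed_point (convex_convexHull ℝ F)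
    (H.isClosed_convexHull hF hFc) hxF
  refine convexHull_mono ?_ (H.mem_convexHull_slice hx m)
  rintro p ⟨hp, hpx⟩
  have hpx : m p = m x := hpx
  exact ⟨hp, fun hpF => by linarith [hm p (subset_convexHull ℝ _ hpF)]⟩

section RelativelyOpen

variable {G : Set Plane} (hG : G ⊆ frontier Ω) (hGo : ∀ p ∈ G, G ∈ 𝓝[frontier Ω] p)
include hG hGo

theorem subset_closure_interior_convexHull :
    convexHull ℝ G ⊆ closure (interior (convexHull ℝ G)) := by
  refine convexHull_min (fun p hp => ?_) (convex_convexHull ℝ G).interior.closure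
  have h := H.convexHull_mem_nhdsWithin (hG hp) (hGo p hp)
  rw [inter_eq_left.2 hG] at h
  obtain ⟨O, hO, hpO, hOG⟩ := mem_nhdsWithin.1 h
  refine mem_closure_iff.2 fun V hV hpV => ?_
  obtain ⟨y, ⟨hyO, hyV⟩, hy⟩ := mem_closure_iff.1 (frontier_subset_closure (hG hp)) (O ∩ V)
    (hO.inter hV) ⟨hpO, hpV⟩
  refine ⟨y, hyV, mem_interior.2 ⟨O ∩ Ω, fun z hz => hOG ⟨hz.1, subset_closure hz.2⟩,
    hO.inter H.isOpen, hyO, hy⟩⟩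

theorem nonempty_interior_convexHull (hne : G.Nonempty) :
    (interior (convexHull ℝ G)).Nonempty :=
  closure_nonempty_iff.1
    ((hne.convexHull (𝕜 := ℝ)).mono (H.subset_closure_interior_convexHull hG hGo))

/-- A supporting line at a non-interior point of the hull in `Ω` would contain a point of `G`, but
`G` has points beyond the line near it. -/
theorem inter_convexHull_subset_interior : Ω ∩ convexHull ℝ G ⊆ interior (convexHull ℝ G) := by
  rintro x ⟨hx, hxG⟩
  by_contra hxI
  obtain ⟨m, hm⟩ := geometric_hahn_banach_open_point (convex_convexHull ℝ G).interior
    isOpen_interior hxI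
  have hle : ∀ y ∈ convexHull ℝ G, m y ≤ m x := fun y hy =>
    closure_minimal (fun z hz => (hm z hz).le) (isClosed_le m.continuous continuous_const)
      (H.subset_closure_interior_convexHull hG hGo hy)
  obtain ⟨z, hz⟩ := H.nonempty_interior_convexHull hG hGo (convexHull_nonempty_iff.1 ⟨x, hxG⟩)
  have hm0 : m ≠ 0 := by rintro rfl; simpa using hm z hz
  obtain ⟨p, hp, -, -, -, hpx, -⟩ := H.exists_chord hx hm0 hG
    (mem_convexHull_inter_of_le (fun p hp => hle p (subset_convexHull ℝ G hp)) hxG)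
  exact (H.frequently_apply_gt hx (hG hp) hm0 hpx)
    (mem_of_superset (hGo p hp) fun q hq => not_lt.2 (hle q (subset_convexHull ℝ G hq)))

theorem convexHull_mem_nhdsWithin_closure {x : Plane} (hx : x ∈ convexHull ℝ G) :
    convexHull ℝ G ∈ 𝓝[closure Ω] x := by
  rcases H.mem_or_mem_frontier (H.convexHull_subset hG hx) with h | h
  · exact mem_nhdsWithin_of_mem_nhds
      (mem_interior_iff_mem_nhds.1 (H.inter_convexHull_subset_interior hG hGo ⟨h, hx⟩))
  · have hxG := H.mem_of_mem_convexHull h hG hx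
    simpa [inter_eq_left.2 hG] using H.convexHull_mem_nhdsWithin h (hGo x hxG)

theorem apply_ne_of_isMaxOn {w p : Plane} (hw : w ∈ Ω) {m : Plane →L[ℝ] ℝ} (hm : m ≠ 0)
    (hle : ∀ q ∈ G, m q ≤ m w) (hp : p ∈ G) : m p ≠ m w := fun h =>
  H.frequently_apply_gt hw (hG hp) hm h
    (mem_of_superset (hGo p hp) fun q hq => not_lt.2 (hle q hq))

end RelativelyOpen

end StrictlyConvexDomain

/-! ### Half circles inside hulls of boundary sets. -/

theorem hausdorffMeasure_sphere_half_le (m : Plane →L[ℝ] ℝ) (x : Plane) (r : ℝ) :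
    (Measure.hausdorffMeasure 1 : Measure Plane) (Metric.sphere x r) / 2 ≤
      (Measure.hausdorffMeasure 1 : Measure Plane) {y ∈ Metric.sphere x r | m x ≤ m y} := by
  set μ : Measure Plane := Measure.hausdorffMeasure 1
  set S := {y ∈ Metric.sphere x r | m x ≤ m y}
  set S' := {y ∈ Metric.sphere x r | m y ≤ m x}
  have hS : S' = (AffineIsometryEquiv.pointReflection ℝ x).toIsometryEquiv '' S := by
    ext y
    constructor
    · rintro ⟨hy, hyx⟩
      have hy : dist y x = r := hy
      refine ⟨AffineIsometryEquiv.pointReflection ℝ x y, ⟨?_, ?_⟩,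
        AffineIsometryEquiv.pointReflection_involutive (𝕜 := ℝ) x y⟩
      · simp [AffineIsometryEquiv.pointReflection_apply, ← hy, dist_eq_norm, norm_sub_rev]
      · simp only [AffineIsometryEquiv.pointReflection_apply, vsub_eq_sub, vadd_eq_add, map_add,
          map_sub]
        linarith
    · rintro ⟨z, ⟨hz, hzx⟩, rfl⟩
      have hz : dist z x = r := hz
      refine ⟨?_, ?_⟩
      · simp [AffineIsometryEquiv.pointReflection_apply, ← hz, dist_eq_norm, norm_sub_rev]
      · simp only [AffineIsometryEquiv.coe_toIsometryEquiv,
          AffineIsometryEquiv.pointReflection_apply, vsub_eq_sub, vadd_eq_add, map_add,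
          map_sub]
        linarith
  have hμ : μ S' = μ S := by rw [hS]; exact IsometryEquiv.hausdorffMeasure_image _ _ _
  have hcov : Metric.sphere x r ⊆ S ∪ S' := fun y hy =>
    (le_total (m x) (m y)).imp (fun h => ⟨hy, h⟩) (fun h => ⟨hy, h⟩)
  refine ENNReal.div_le_of_le_mul ?_
  calc μ (Metric.sphere x r) ≤ μ S + μ S' := (measure_mono hcov).trans (measure_union_le _ _)
    _ = μ S * 2 := by rw [hμ, mul_two]

theorem Metric.closedBall_subset_of_lt_infDist_frontier {V : Type*} [NormedAddCommGroup V]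
    [NormedSpace ℝ V] {Ω : Set V} {x : V} (hx : x ∈ Ω) {r : ℝ}
    (hr : r < Metric.infDist x (frontier Ω)) : Metric.closedBall x r ⊆ Ω := by
  intro y hy
  by_contra hyΩ
  have hr0 : 0 ≤ r := dist_nonneg.trans (Metric.mem_closedBall.1 hy)
  obtain ⟨w, hw, hwf⟩ := (convex_closedBall x r).isPreconnected.exists_mem_frontier
    (Metric.mem_closedBall_self hr0) hx hy hyΩ
  have h1 := Metric.infDist_le_dist_of_mem hwf (x := x)
  rw [dist_comm] at h1
  exact absurd (h1.trans (Metric.mem_closedBall.1 hw)) (not_le.2 hr)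

/-- The sign analysis behind the triangle lemma: `α, β, γ` are barycentric coordinates with respect
to `a, b, y`, and the other letters are signed heights over two separating lines. The converse below
recovers the signs of `α` and `β` from that of `γ`. -/
theorem det_nonpos_of_nonneg {α β γ A1 B1 Y1 A2 B2 Y2 : ℝ} (hα : 0 ≤ α) (hβ : 0 ≤ β) (hγ : 0 ≤ γ)
    (hsum : α + β + γ = 1) (hA1 : 0 < A1) (hY1 : 0 < Y1) (hB2 : 0 < B2) (hY2 : 0 < Y2)
    (f1 : α * A1 + γ * Y1 ≤ β * B1) (f2 : β * B2 + γ * Y2 ≤ α * A2) :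
    0 < B1 ∧ 0 < A2 ∧ A1 * B2 ≤ B1 * A2 := by
  have hγ1 := mul_nonneg hγ hY1.le
  have hγ2 := mul_nonneg hγ hY2.le
  have hα0 : 0 < α := by
    refine hα.lt_of_ne fun h => ?_
    subst h
    have : 0 < β ∨ 0 < γ := by by_contra! h; linarith
    rcases this with h | h
    · linarith [mul_pos h hB2]
    · linarith [mul_pos h hY2, mul_nonneg hβ hB2.le]
  have hβ0 : 0 < β := by
    refine hβ.lt_of_ne fun h => ?_
    subst h
    linarith [mul_pos hα0 hA1]
  have g1 : α * A1 ≤ β * B1 := by linarith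
  have g2 : β * B2 ≤ α * A2 := by linarith
  refine ⟨pos_of_mul_pos_right (lt_of_lt_of_le (mul_pos hα0 hA1) g1) hβ0.le,
    pos_of_mul_pos_right (lt_of_lt_of_le (mul_pos hβ0 hB2) g2) hα0.le, ?_⟩
  have := mul_le_mul g1 g2 (by positivity) ((mul_pos hα0 hA1).le.trans g1)
  refine le_of_mul_le_mul_left ?_ (mul_pos hα0 hβ0)
  linarith

theorem nonneg_of_det_nonpos {α β γ A1 B1 Y1 A2 B2 Y2 : ℝ} (hγ : 0 ≤ γ) (hsum : α + β + γ = 1)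
    (hA1 : 0 < A1) (hB1 : 0 < B1) (hY1 : 0 < Y1) (hA2 : 0 < A2) (hB2 : 0 < B2) (hY2 : 0 < Y2)
    (hdet : A1 * B2 ≤ B1 * A2)
    (f1 : α * A1 + γ * Y1 ≤ β * B1) (f2 : β * B2 + γ * Y2 ≤ α * A2) : 0 ≤ α ∧ 0 ≤ β := by
  have hneg : ¬ (α < 0 ∧ β < 0) := by
    rintro ⟨hα1, hβ1⟩
    have hγ1 : 0 < γ := by linarith
    have i1 : -β * B1 < -α * A1 := by linarith [mul_pos hγ1 hY1]
    have i2 : -α * A2 < -β * B2 := by linarith [mul_pos hγ1 hY2]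
    have i3 := mul_lt_mul'' i1 i2 (mul_pos (neg_pos.2 hβ1) hB1).le (mul_pos (neg_pos.2 hα1) hA2).le
    have i4 := mul_le_mul_of_nonneg_left hdet (mul_pos_of_neg_of_neg hα1 hβ1).le
    linarith
  constructor
  · by_contra! h
    refine hneg ⟨h, neg_of_mul_neg_left (b := B2) ?_ hB2.le⟩
    linarith [mul_nonneg hγ hY2.le, mul_pos (neg_pos.2 h) hA2]
  · by_contra! h
    refine hneg ⟨neg_of_mul_neg_left (b := A1) ?_ hA1.le, h⟩
    linarith [mul_nonneg hγ hY1.le, mul_pos (neg_pos.2 h) hB1]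

theorem Plane.exists_barycentric {a b y : Plane}
    (h : (a 0 - y 0) * (b 1 - y 1) - (a 1 - y 1) * (b 0 - y 0) ≠ 0) (p : Plane) :
    ∃ α β γ : ℝ, α + β + γ = 1 ∧ p = α • a + β • b + γ • y := by
  obtain ⟨Δ, hΔ⟩ : ∃ t, t = (a 0 - y 0) * (b 1 - y 1) - (a 1 - y 1) * (b 0 - y 0) := ⟨_, rfl⟩
  rw [← hΔ] at h
  refine ⟨((p 0 - y 0) * (b 1 - y 1) - (p 1 - y 1) * (b 0 - y 0)) / Δ,
    ((a 0 - y 0) * (p 1 - y 1) - (a 1 - y 1) * (p 0 - y 0)) / Δ,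
    1 - ((p 0 - y 0) * (b 1 - y 1) - (p 1 - y 1) * (b 0 - y 0)) / Δ -
    ((a 0 - y 0) * (p 1 - y 1) - (a 1 - y 1) * (p 0 - y 0)) / Δ, by ring, ?_⟩
  ext i
  fin_cases i
  · simp only [Fin.zero_eta, PiLp.add_apply, PiLp.smul_apply, smul_eq_mul]
    field_simp
    rw [hΔ]; ring
  · simp only [Fin.mk_one, PiLp.add_apply, PiLp.smul_apply, smul_eq_mul]
    field_simp
    rw [hΔ]; ring

namespace StrictlyConvexDomain

variable {Ω : Set Plane} (H : StrictlyConvexDomain Ω)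
include H

/-- If two sides of a triangle in the domain are separated from `convexHull ℝ F`, then so is the
triangle, provided that `F` lies on the boundary. -/
theorem notMem_convexHull_triple {F : Set Plane} (hF : F ⊆ frontier Ω) {a b y k : Plane}
    (ha : a ∈ Ω) (hb : b ∈ Ω) (hy : y ∈ Ω) {m₁ m₂ : Plane →L[ℝ] ℝ} {s₁ s₂ : ℝ}
    (h1a : s₁ < m₁ a) (h1y : s₁ < m₁ y) (h1F : ∀ p ∈ F, m₁ p ≤ s₁)
    (h2b : s₂ < m₂ b) (h2y : s₂ < m₂ y) (h2F : ∀ p ∈ F, m₂ p ≤ s₂)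
    (hk : k ∈ convexHull ℝ F) : k ∉ convexHull ℝ {a, b, y} := by
  intro hkT
  obtain ⟨α, β, γ, hα, hβ, hγ, hsum, rfl⟩ : ∃ α β γ : ℝ, 0 ≤ α ∧ 0 ≤ β ∧ 0 ≤ γ ∧ α + β + γ = 1 ∧
      α • a + β • b + γ • y = k := by
    rw [convexHull_insert (by simp), convexHull_pair] at hkT
    obtain ⟨_, rfl, c, ⟨u, v, hu, hv, huv, rfl⟩, ⟨s, t, hs, ht, hst, rfl⟩⟩ := mem_convexJoin.1 hkT
    refine ⟨s, t * u, t * v, hs, by positivity, by positivity, ?_, by module⟩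
    rw [add_assoc, ← mul_add, huv, mul_one, hst]
  have e1 := le_of_mem_convexHull h1F hk
  have e2 := le_of_mem_convexHull h2F hk
  simp only [map_add, map_smul, smul_eq_mul] at e1 e2
  obtain ⟨A1, hA1⟩ : ∃ t, t = m₁ a - s₁ := ⟨_, rfl⟩
  obtain ⟨B1, hB1⟩ : ∃ t, t = s₁ - m₁ b := ⟨_, rfl⟩
  obtain ⟨Y1, hY1⟩ : ∃ t, t = m₁ y - s₁ := ⟨_, rfl⟩
  obtain ⟨A2, hA2⟩ : ∃ t, t = s₂ - m₂ a := ⟨_, rfl⟩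
  obtain ⟨B2, hB2⟩ : ∃ t, t = m₂ b - s₂ := ⟨_, rfl⟩
  obtain ⟨Y2, hY2⟩ : ∃ t, t = m₂ y - s₂ := ⟨_, rfl⟩
  have hA1p : 0 < A1 := by linarith
  have hY1p : 0 < Y1 := by linarith
  have hB2p : 0 < B2 := by linarith
  have hY2p : 0 < Y2 := by linarith
  have f1 : α * A1 + γ * Y1 ≤ β * B1 := by
    rw [hA1, hB1, hY1]; linear_combination e1 - s₁ * hsum
  have f2 : β * B2 + γ * Y2 ≤ α * A2 := by
    rw [hA2, hB2, hY2]; linear_combination e2 - s₂ * hsum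
  obtain ⟨hB1p, hA2p, hdet⟩ := det_nonpos_of_nonneg hα hβ hγ hsum hA1p hY1p hB2p hY2p f1 f2
  obtain ⟨Δ, hΔ⟩ : ∃ t, t = (a 0 - y 0) * (b 1 - y 1) - (a 1 - y 1) * (b 0 - y 0) := ⟨_, rfl⟩
  -- `Δ` is twice the signed area of the triangle. If it vanished, so would the determinant of the
  -- heights, which `hdet` makes negative.
  have hΔ0 : Δ ≠ 0 := by
    intro h0
    have : (A1 - Y1) * (B2 - Y2) - (-B1 - Y1) * (-A2 - Y2) = 0 := by
      rw [hA1, hB1, hY1, hA2, hB2, hY2, Plane.apply_eq m₁ a, Plane.apply_eq m₁ b,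
        Plane.apply_eq m₁ y, Plane.apply_eq m₂ a, Plane.apply_eq m₂ b, Plane.apply_eq m₂ y]
      rw [h0] at hΔ
      linear_combination -(m₁ (EuclideanSpace.single 0 1) * m₂ (EuclideanSpace.single 1 1) -
        m₁ (EuclideanSpace.single 1 1) * m₂ (EuclideanSpace.single 0 1)) * hΔ
    linarith [mul_pos hA1p hY2p, mul_pos hY1p hB2p, mul_pos hB1p hY2p, mul_pos hY1p hA2p]
  -- Some `p ∈ F` is at least as far as `k` from the line `ab`, on the side of `y`, so `γ' ≥ γ ≥ 0`.
  -- The half-plane constraints then put `p` into the triangle, hence into `Ω`.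
  obtain ⟨p, hp, hpk⟩ := exists_apply_le_of_mem_convexHull (Δ • detForm (b - a)) hk
  obtain ⟨α', β', γ', hsum', hpe⟩ := Plane.exists_barycentric (hΔ ▸ hΔ0) p
  have hγ0 : 0 ≤ γ' := by
    have hb' : (Δ • detForm (b - a)) b = (Δ • detForm (b - a)) a := by
      simp only [smul_apply, detForm_apply, smul_eq_mul, PiLp.sub_apply]; ring
    have hy' : (Δ • detForm (b - a)) y = (Δ • detForm (b - a)) a + Δ * Δ := by
      simp only [smul_apply, detForm_apply, smul_eq_mul, PiLp.sub_apply]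
      rw [← mul_add]; congr 1; rw [hΔ]; ring
    rw [hpe] at hpk
    generalize Δ • detForm (b - a) = ℓ at hpk hb' hy'
    simp only [map_add, map_smul, smul_eq_mul, hb', hy'] at hpk
    have hsq : 0 < Δ * Δ := mul_self_pos.2 hΔ0
    have : γ * (Δ * Δ) ≤ γ' * (Δ * Δ) := by
      linear_combination hpk + ℓ a * hsum' - ℓ a * hsum
    exact hγ.trans (le_of_mul_le_mul_right this hsq)
  have k1 := h1F p hp
  have k2 := h2F p hp
  rw [hpe] at k1 k2
  simp only [map_add, map_smul, smul_eq_mul] at k1 k2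
  obtain ⟨hα0', hβ0'⟩ := nonneg_of_det_nonpos (α := α') (β := β') hγ0 hsum' hA1p hB1p hY1p hA2p
    hB2p hY2p hdet (by rw [hA1, hB1, hY1]; linear_combination k1 - s₁ * hsum')
    (by rw [hA2, hB2, hY2]; linear_combination k2 - s₂ * hsum')
  refine H.notMem_of_mem_frontier (hF hp) ?_
  have hT : p ∈ convexHull ℝ {a, b, y} := by
    rw [hpe]
    have := (convex_convexHull ℝ ({a, b, y} : Set Plane)).sum_mem (t := Finset.univ)
      (w := ![α', β', γ']) (z := ![a, b, y])
      (by intro i _; fin_cases i <;> simp [hα0', hβ0', hγ0])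
      (by simpa [Fin.sum_univ_three] using hsum')
      (by intro i _; fin_cases i <;> exact subset_convexHull ℝ _ (by simp))
    simpa [Fin.sum_univ_three] using this
  refine convexHull_min ?_ H.convex hT
  rintro _ (rfl | rfl | rfl) <;> assumption

/-- A closed convex set spanned by boundary points and containing a fixed disc contains half of
each small circle about each of its points, with a uniform bound for the radius. -/
theorem exists_halfCircle_subset {F : Set Plane} (hF : F ⊆ frontier Ω) (hFc : IsClosed F)
    {x z : Plane} {ρ δ D r : ℝ} (hx : x ∈ convexHull ℝ F)
    (hz : Metric.closedBall z ρ ⊆ convexHull ℝ F) (hρ : 0 < ρ) (hD : dist z x ≤ D)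
    (hδ : Metric.closedBall x δ ⊆ Ω) (hr : 0 < r) (hrδ : r ≤ δ) (hrρ : 2 * r ≤ ρ)
    (hrD : 2 * r * D ≤ ρ * δ) :
    ∃ m : Plane →L[ℝ] ℝ, ∀ a ∈ Metric.sphere x r, m x ≤ m a → a ∈ convexHull ℝ F := by
  -- The point `y` lies beyond `x` as seen from `z`; `hrD` keeps it in `Ω`. The factor 2 pays for
  -- the extrapolation at the end.
  set y : Plane := x + (2 * r / ρ) • (x - z) with hy
  have hyΩ : y ∈ Ω := by
    refine hδ ?_
    rw [Metric.mem_closedBall, hy, dist_eq_norm, add_sub_cancel_left, norm_smul, ← dist_eq_norm,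
      dist_comm, Real.norm_of_nonneg (by positivity), div_mul_eq_mul_div, div_le_iff₀ hρ]
    nlinarith
  have hcl := H.isClosed_convexHull hF hFc
  -- The points of `Ω` that a single line separates from `F` together with `y`. The common point `y`
  -- is what makes this set convex, by the triangle lemma.
  set C : Set Plane := {a | a ∈ Ω ∧ ∃ (m : Plane →L[ℝ] ℝ) (s : ℝ), s < m a ∧ s < m y ∧
    ∀ p ∈ F, m p ≤ s}
  have hCo : IsOpen C := by
    rw [isOpen_iff_mem_nhds]
    rintro a ⟨ha, m, s, hma, hmy, hmF⟩
    filter_upwards [H.isOpen.mem_nhds ha,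
      (isOpen_lt continuous_const m.continuous).mem_nhds hma] with b hb hmb
    exact ⟨hb, m, s, hmb, hmy, hmF⟩
  have hCc : Convex ℝ C := by
    rintro a ⟨ha, m₁, s₁, h1a, h1y, h1F⟩ b ⟨hb, m₂, s₂, h2b, h2y, h2F⟩ u v hu hv huv
    refine ⟨H.convex ha hb hu hv huv, ?_⟩
    obtain ⟨m, s, s', hms, hss, hms'⟩ := geometric_hahn_banach_compact_closed
      (convex_convexHull ℝ F)
      (H.isCompact_closure.of_isClosed_subset hcl (H.convexHull_subset hF))
      (convex_convexHull ℝ {a, b, y})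
      ((Set.toFinite {a, b, y}).isCompact_convexHull ℝ).isClosed
      (disjoint_left.2 fun k hk =>
        H.notMem_convexHull_triple hF ha hb hyΩ h1a h1y h1F h2b h2y h2F hk)
    exact ⟨m, s, hss.trans (hms' _ (convex_convexHull ℝ _ (subset_convexHull ℝ _ (by simp))
        (subset_convexHull ℝ _ (by simp)) hu hv huv)),
      hss.trans (hms' _ (subset_convexHull ℝ _ (by simp))),
      fun p hp => (hms p (subset_convexHull ℝ F hp)).le⟩
  have hxC : x ∉ C := by
    rintro ⟨-, m, s, hmx, -, hmF⟩
    exact absurd (le_of_mem_convexHull hmF hx) (not_le.2 hmx)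
  obtain ⟨m, hm⟩ := geometric_hahn_banach_open_point hCc hCo hxC
  refine ⟨m, fun a ha hxa => ?_⟩
  by_contra haF
  refine absurd (hm a ⟨hδ (Metric.sphere_subset_closedBall.trans
    (Metric.closedBall_subset_closedBall hrδ) ha), ?_⟩) (not_lt.2 hxa)
  obtain ⟨e, s, he, hea⟩ := geometric_hahn_banach_closed_point (convex_convexHull ℝ F) hcl haF
  refine ⟨e, s, hea, ?_, fun p hp => (he p (subset_convexHull ℝ F hp)).le⟩
  have hex := he x hx
  -- As `e < s` on the whole disc, `e z` is below `s` by more than `ρ / r` times `e a - e x`.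
  -- Extrapolating from `z` through `x` gives `e y > s`, so `a ∈ C`.
  have hez := he (z + (ρ / r) • (a - x)) (hz (by
    rw [Metric.mem_closedBall, dist_eq_norm, add_sub_cancel_left, norm_smul, ← dist_eq_norm,
      Metric.mem_sphere.1 ha, Real.norm_of_nonneg (by positivity), div_mul_cancel₀ _ hr.ne']))
  simp only [map_add, map_smul, map_sub, smul_eq_mul] at hez
  rw [hy]
  simp only [map_add, map_smul, map_sub, smul_eq_mul]
  have hρr : 2 * r / ρ * (ρ / r) = 2 := by field_simp
  have ht : 2 * r / ρ ≤ 1 := (div_le_one hρ).2 hrρ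
  have ht0 : 0 < 2 * r / ρ := by positivity
  set t := 2 * r / ρ
  have hA : 0 < e a - e x := by linarith
  have h1 : t * (e z + ρ / r * (e a - e x)) < t * s := mul_lt_mul_of_pos_left hez ht0
  have h2 : t * (e z + ρ / r * (e a - e x)) = t * e z + 2 * (e a - e x) := by
    rw [mul_add, ← mul_assoc, hρr]
  nlinarith

end StrictlyConvexDomain

/-! ### The envelopes, their sublevel sets and their continuity. -/

/-- The quasiconvex envelope: the largest function on `closure Ω` with convex sublevel sets that is
at most `h` on the boundary. -/
noncomputable def lowerEnvelope (Ω : Set Plane) (h : Plane → ℝ) (x : Plane) : ℝ :=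
  sInf {c | x ∈ convexHull ℝ {p ∈ frontier Ω | h p ≤ c}}

/-- The quasiconcave envelope. -/
noncomputable def upperEnvelope (Ω : Set Plane) (h : Plane → ℝ) (x : Plane) : ℝ :=
  -lowerEnvelope Ω (-h) x

/-- The constant `c₀`, clamped between the quasiconvex and the quasiconcave envelope. -/
noncomputable def clampedEnvelope (Ω : Set Plane) (h : Plane → ℝ) (c₀ : ℝ) (x : Plane) : ℝ :=
  max (lowerEnvelope Ω h x) (min (upperEnvelope Ω h x) c₀)

namespace StrictlyConvexDomain

variable {Ω : Set Plane} (H : StrictlyConvexDomain Ω) {h : Plane → ℝ} (hh : Continuous h)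
include H hh

omit H in
theorem isClosed_sublevel (c : ℝ) : IsClosed {p ∈ frontier Ω | h p ≤ c} :=
  isClosed_frontier.inter (isClosed_le hh continuous_const)

omit H in
theorem strictSublevel_mem_nhdsWithin (c : ℝ) :
    ∀ p ∈ {p ∈ frontier Ω | h p < c}, {p ∈ frontier Ω | h p < c} ∈ 𝓝[frontier Ω] p :=
  fun _ hp => inter_mem self_mem_nhdsWithin
    (mem_nhdsWithin_of_mem_nhds ((isOpen_lt hh continuous_const).mem_nhds hp.2))

theorem bddBelow_levels (x : Plane) :
    BddBelow {c | x ∈ convexHull ℝ {p ∈ frontier Ω | h p ≤ c}} := by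
  obtain ⟨B, hB⟩ := (H.isCompact_frontier.image hh).bddBelow
  refine ⟨B, fun c hc => ?_⟩
  obtain ⟨p, hp⟩ := convexHull_nonempty_iff.1 ⟨x, hc⟩
  exact (hB (mem_image_of_mem h hp.1)).trans hp.2

theorem nonempty_levels {x : Plane} (hx : x ∈ closure Ω) :
    {c | x ∈ convexHull ℝ {p ∈ frontier Ω | h p ≤ c}}.Nonempty := by
  obtain ⟨B, hB⟩ := (H.isCompact_frontier.image hh).bddAbove
  exact ⟨B, convexHull_mono (t := {p ∈ frontier Ω | h p ≤ B})
    (fun p hp => ⟨hp, hB (mem_image_of_mem h hp)⟩) (H.mem_convexHull_frontier hx)⟩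

theorem exists_lt_of_lowerEnvelope_lt {x : Plane} (hx : x ∈ closure Ω) {c : ℝ}
    (hc : lowerEnvelope Ω h x < c) : ∃ c' < c, x ∈ convexHull ℝ {p ∈ frontier Ω | h p ≤ c'} := by
  obtain ⟨c', hc', hlt⟩ := exists_lt_of_csInf_lt (H.nonempty_levels hh hx) hc
  exact ⟨c', hlt, hc'⟩

/-- The infimum is attained: if a line cuts `x` off from the hull at level `c`, then by compactness
`h` has a minimum above `c` on the boundary beyond it, and no level in between can reach `x`. -/
theorem lowerEnvelope_le_iff {x : Plane} (hx : x ∈ closure Ω) {c : ℝ} :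
    lowerEnvelope Ω h x ≤ c ↔ x ∈ convexHull ℝ {p ∈ frontier Ω | h p ≤ c} := by
  refine ⟨fun hc => ?_, fun hc => csInf_le (H.bddBelow_levels hh x) hc⟩
  by_contra hxc
  obtain ⟨m, s, hm, hs⟩ := geometric_hahn_banach_closed_point (convex_convexHull ℝ _)
    (H.isClosed_convexHull (sep_subset _ _) (isClosed_sublevel hh c)) hxc
  have key : ∀ c' > c, ∃ p ∈ frontier Ω ∩ {p | m x ≤ m p}, h p < c' := by
    intro c' hc'
    obtain ⟨c₁, hc₁, hx₁⟩ := H.exists_lt_of_lowerEnvelope_lt hh hx (hc.trans_lt hc')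
    obtain ⟨p, hp, hxp⟩ := exists_apply_le_of_mem_convexHull m hx₁
    exact ⟨p, ⟨hp.1, hxp⟩, hp.2.trans_lt hc₁⟩
  obtain ⟨p, hp, -⟩ := key (c + 1) (by linarith)
  obtain ⟨q, hq, hqmin⟩ := (H.isCompact_frontier.inter_right
    (isClosed_le continuous_const m.continuous)).exists_isMinOn ⟨p, hp⟩ hh.continuousOn
  have hcq : c < h q := by
    by_contra! hcon
    have hq2 : m x ≤ m q := hq.2
    have hqc : q ∈ {p ∈ frontier Ω | h p ≤ c} := ⟨hq.1, hcon⟩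
    linarith [hm q (subset_convexHull ℝ _ hqc)]
  obtain ⟨p, hp, hlt⟩ := key _ hcq
  exact absurd (hqmin hp) (not_le.2 hlt)

theorem lowerEnvelope_lt_iff {x : Plane} (hx : x ∈ closure Ω) {c : ℝ} :
    lowerEnvelope Ω h x < c ↔ x ∈ convexHull ℝ {p ∈ frontier Ω | h p < c} := by
  constructor
  · intro hc
    obtain ⟨c', hc', hx'⟩ := H.exists_lt_of_lowerEnvelope_lt hh hx hc
    refine convexHull_mono ?_ hx'
    exact fun p hp => ⟨hp.1, hp.2.trans_lt hc'⟩
  · intro hxc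
    refine (convexHull_min (t := {z | z ∈ closure Ω ∧ lowerEnvelope Ω h z < c}) ?_ ?_ hxc).2
    · rintro p ⟨hp, hpc⟩
      exact ⟨frontier_subset_closure hp,
        ((H.lowerEnvelope_le_iff hh (frontier_subset_closure hp)).2
          (subset_convexHull ℝ _ ⟨hp, le_rfl⟩)).trans_lt hpc⟩
    · rintro a ⟨ha, hac⟩ b ⟨hb, hbc⟩ s t hs ht hst
      have hz := H.convex_closure ha hb hs ht hst
      refine ⟨hz, lt_of_le_of_lt ?_ (max_lt hac hbc)⟩
      rw [H.lowerEnvelope_le_iff hh hz]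
      exact convex_convexHull ℝ _ ((H.lowerEnvelope_le_iff hh ha).1 (le_max_left _ _))
        ((H.lowerEnvelope_le_iff hh hb).1 (le_max_right _ _)) hs ht hst

theorem continuousOn_lowerEnvelope : ContinuousOn (lowerEnvelope Ω h) (closure Ω) := by
  intro x hx
  refine tendsto_order.2 ⟨fun c hc => ?_, fun c hc => ?_⟩
  · have hxc : x ∉ convexHull ℝ {p ∈ frontier Ω | h p ≤ c} := fun hcon =>
      absurd ((H.lowerEnvelope_le_iff hh hx).2 hcon) (not_le.2 hc)
    have hcl := H.isClosed_convexHull (sep_subset _ _) (isClosed_sublevel hh c)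
    filter_upwards [self_mem_nhdsWithin,
      mem_nhdsWithin_of_mem_nhds (hcl.isOpen_compl.mem_nhds hxc)] with y hy hyc
    exact not_le.1 fun hcon => hyc ((H.lowerEnvelope_le_iff hh hy).1 hcon)
  · filter_upwards [self_mem_nhdsWithin, H.convexHull_mem_nhdsWithin_closure (sep_subset _ _)
      (strictSublevel_mem_nhdsWithin hh c) ((H.lowerEnvelope_lt_iff hh hx).1 hc)] with y hy hyc
    exact (H.lowerEnvelope_lt_iff hh hy).2 hyc

theorem lowerEnvelope_eq_of_mem_frontier {p : Plane} (hp : p ∈ frontier Ω) :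
    lowerEnvelope Ω h p = h p := by
  have hpc := frontier_subset_closure hp
  refine le_antisymm ((H.lowerEnvelope_le_iff hh hpc).2 (subset_convexHull ℝ _ ⟨hp, le_rfl⟩)) ?_
  exact (H.mem_of_mem_convexHull hp (sep_subset _ _) ((H.lowerEnvelope_le_iff hh hpc).1 le_rfl)).2

theorem lt_upperEnvelope_iff {x : Plane} (hx : x ∈ closure Ω) {c : ℝ} :
    c < upperEnvelope Ω h x ↔ x ∈ convexHull ℝ {p ∈ frontier Ω | c < h p} := by
  rw [upperEnvelope, lt_neg, H.lowerEnvelope_lt_iff hh.neg hx]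
  simp

theorem lowerEnvelope_le_upperEnvelope {x : Plane} (hx : x ∈ closure Ω) :
    lowerEnvelope Ω h x ≤ upperEnvelope Ω h x := by
  refine le_of_forall_lt fun c hc => (H.lt_upperEnvelope_iff hh hx).2 ?_
  refine convexHull_mono ?_ (H.mem_convexHull_diff (sep_subset _ _) (isClosed_sublevel hh c) hx
    fun hcon => absurd ((H.lowerEnvelope_le_iff hh hx).2 hcon) (not_le.2 hc))
  exact fun p hp => ⟨hp.1, not_le.1 fun hpc => hp.2 ⟨hp.1, hpc⟩⟩

/-- Because the lower envelope is at most the upper one, the clamp is a median of three numbers,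
hence odd. This transfers every statement above `c₀` to one below. -/
theorem clampedEnvelope_neg {x : Plane} (hx : x ∈ closure Ω) (c₀ : ℝ) :
    clampedEnvelope Ω (-h) (-c₀) x = -clampedEnvelope Ω h c₀ x := by
  have hle := H.lowerEnvelope_le_upperEnvelope hh hx
  have e : lowerEnvelope Ω (-h) x = -upperEnvelope Ω h x := by simp [upperEnvelope]
  have e' : upperEnvelope Ω (-h) x = -lowerEnvelope Ω h x := by simp [upperEnvelope]
  rw [clampedEnvelope, clampedEnvelope, e, e', min_neg_neg, max_neg_neg, neg_inj]
  rcases le_total (lowerEnvelope Ω h x) c₀ with h1 | h1 <;>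
  rcases le_total (upperEnvelope Ω h x) c₀ with h2 | h2 <;>
  simp only [h1, h2, min_eq_left, min_eq_right, max_eq_left, max_eq_right, hle]; linarith

variable {c₀ : ℝ}

theorem continuousOn_clampedEnvelope : ContinuousOn (clampedEnvelope Ω h c₀) (closure Ω) :=
  (H.continuousOn_lowerEnvelope hh).sup
    (((H.continuousOn_lowerEnvelope hh.neg).neg).inf continuousOn_const)

theorem clampedEnvelope_eq_of_mem_frontier {p : Plane} (hp : p ∈ frontier Ω) :
    clampedEnvelope Ω h c₀ p = h p := by
  rw [clampedEnvelope, upperEnvelope, H.lowerEnvelope_eq_of_mem_frontier hh hp,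
    H.lowerEnvelope_eq_of_mem_frontier hh.neg hp]
  simp

theorem clampedEnvelope_le_iff {x : Plane} (hx : x ∈ closure Ω) {c : ℝ} (hc : c₀ ≤ c) :
    clampedEnvelope Ω h c₀ x ≤ c ↔ x ∈ convexHull ℝ {p ∈ frontier Ω | h p ≤ c} := by
  rw [← H.lowerEnvelope_le_iff hh hx, clampedEnvelope, max_le_iff]
  exact ⟨And.left, fun h => ⟨h, (min_le_right _ _).trans hc⟩⟩

theorem clampedEnvelope_lt_iff {x : Plane} (hx : x ∈ closure Ω) {c : ℝ} (hc : c₀ < c) :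
    clampedEnvelope Ω h c₀ x < c ↔ x ∈ convexHull ℝ {p ∈ frontier Ω | h p < c} := by
  rw [← H.lowerEnvelope_lt_iff hh hx, clampedEnvelope, max_lt_iff]
  exact ⟨And.left, fun h => ⟨h, (min_le_right _ _).trans_lt hc⟩⟩

theorem le_clampedEnvelope_iff {x : Plane} (hx : x ∈ closure Ω) {c : ℝ} (hc : c ≤ c₀) :
    c ≤ clampedEnvelope Ω h c₀ x ↔ x ∈ convexHull ℝ {p ∈ frontier Ω | c ≤ h p} := by
  rw [← neg_le_neg_iff, ← H.clampedEnvelope_neg hh hx,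
    H.clampedEnvelope_le_iff hh.neg hx (neg_le_neg hc)]
  simp

theorem lt_clampedEnvelope_iff {x : Plane} (hx : x ∈ closure Ω) {c : ℝ} (hc : c < c₀) :
    c < clampedEnvelope Ω h c₀ x ↔ x ∈ convexHull ℝ {p ∈ frontier Ω | c < h p} := by
  rw [← neg_lt_neg_iff, ← H.clampedEnvelope_neg hh hx,
    H.clampedEnvelope_lt_iff hh.neg hx (neg_lt_neg hc)]
  simp

/-! ### The local median value property. -/

theorem nonempty_interior_sublevel (hc₀ : ∃ p ∈ frontier Ω, h p < c₀) {c : ℝ} (hc : c₀ ≤ c) :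
    (interior (convexHull ℝ {p ∈ frontier Ω | h p ≤ c})).Nonempty := by
  refine (H.nonempty_interior_convexHull (sep_subset _ _) (strictSublevel_mem_nhdsWithin hh c₀)
    hc₀).mono (interior_mono (convexHull_mono fun p hp => ⟨hp.1, ?_⟩))
  exact hp.2.le.trans hc

/-- The sublevel sets of the clamped envelope contain half of each small circle, for radii
proportional to the distance from the boundary. -/
theorem exists_radius_factor (hc₀ : ∃ p ∈ frontier Ω, h p < c₀) :
    ∃ κ : ℝ, 0 < κ ∧ κ ≤ 1 / 2 ∧ ∀ x ∈ Ω, ∀ r : ℝ, 0 < r →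
      r ≤ κ * Metric.infDist x (frontier Ω) →
      (Measure.hausdorffMeasure 1 : Measure Plane) (Metric.sphere x r) / 2 ≤
        (Measure.hausdorffMeasure 1 : Measure Plane)
          {s ∈ Metric.sphere x r | clampedEnvelope Ω h c₀ s ≤ clampedEnvelope Ω h c₀ x} := by
  obtain ⟨z, hz⟩ := H.nonempty_interior_sublevel hh hc₀ le_rfl
  obtain ⟨ρ, hρ, hball⟩ := Metric.nhds_basis_closedBall.mem_iff.1 (mem_interior_iff_mem_nhds.1 hz)
  have hzΩ : z ∈ closure Ω := H.convexHull_subset (sep_subset _ _) (interior_subset hz)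
  obtain ⟨D, hD0, hD⟩ : ∃ D : ℝ, 0 < D ∧ ∀ a ∈ closure Ω, ∀ b ∈ closure Ω, dist a b ≤ D := by
    obtain ⟨D, hD⟩ := Metric.isBounded_iff.1 H.isCompact_closure.isBounded
    exact ⟨max D 1, by positivity, fun a ha b hb => (hD ha hb).trans (le_max_left _ _)⟩
  -- With `δ / 2` as the admissible radius about `x`, the half-circle lemma needs `r ≤ δ / 2` and `2
  -- r D ≤ ρ δ / 2`; then `2 r ≤ ρ` follows from `δ ≤ D`.
  refine ⟨min (1 / 2) (ρ / (4 * D)), by positivity, min_le_left _ _, fun x hx r hr hrx => ?_⟩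
  have hxc := subset_closure hx
  obtain ⟨δ, hδ⟩ : ∃ δ, δ = Metric.infDist x (frontier Ω) := ⟨_, rfl⟩
  rw [← hδ] at hrx
  have hδ0 : 0 < δ := by
    by_contra! hcon
    have : min (1 / 2) (ρ / (4 * D)) * δ ≤ 0 :=
      mul_nonpos_of_nonneg_of_nonpos (by positivity) hcon
    linarith
  have hδD : δ ≤ D := by
    obtain ⟨p, hp, -⟩ := hc₀
    rw [hδ]
    exact (Metric.infDist_le_dist_of_mem hp).trans (hD x hxc p (frontier_subset_closure hp))
  have hr1 : r ≤ δ / 2 := hrx.trans (by nlinarith [min_le_left (1 / 2 : ℝ) (ρ / (4 * D))])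
  have hr2 : r * (4 * D) ≤ ρ * δ := by
    have : r ≤ ρ / (4 * D) * δ := hrx.trans (by gcongr; exact min_le_right _ _)
    rwa [div_mul_eq_mul_div, le_div_iff₀ (by positivity)] at this
  have hΩ : Metric.closedBall x (δ / 2) ⊆ Ω :=
    Metric.closedBall_subset_of_lt_infDist_frontier hx (by rw [← hδ]; linarith)
  have hsph : ∀ a ∈ Metric.sphere x r, a ∈ Ω := fun a ha =>
    hΩ (Metric.closedBall_subset_closedBall hr1 (Metric.sphere_subset_closedBall ha))
  obtain ⟨m, hm⟩ : ∃ m : Plane →L[ℝ] ℝ, ∀ a ∈ Metric.sphere x r, m x ≤ m a →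
      clampedEnvelope Ω h c₀ a ≤ clampedEnvelope Ω h c₀ x := by
    rcases le_or_gt c₀ (clampedEnvelope Ω h c₀ x) with hc | hc
    · obtain ⟨m, hm⟩ := H.exists_halfCircle_subset (sep_subset _ _)
        (isClosed_sublevel hh _) ((H.clampedEnvelope_le_iff hh hxc hc).1 le_rfl)
        (hball.trans (convexHull_mono fun p hp => ⟨hp.1, hp.2.trans hc⟩)) hρ
        (hD z hzΩ x hxc) hΩ hr hr1 (by nlinarith) (by nlinarith)
      exact ⟨m, fun a ha hxa => (H.clampedEnvelope_le_iff hh (subset_closure (hsph a ha)) hc).2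
        (hm a ha hxa)⟩
    -- Below `c₀` it is the strict superlevel set that is a hull, open in `Ω` and missing `x`; a
    -- half-plane at `x` avoids it.
    · have hopen : ∀ p ∈ {p ∈ frontier Ω | clampedEnvelope Ω h c₀ x < h p},
          {p ∈ frontier Ω | clampedEnvelope Ω h c₀ x < h p} ∈ 𝓝[frontier Ω] p := by
        simpa using strictSublevel_mem_nhdsWithin (Ω := Ω) hh.neg (-clampedEnvelope Ω h c₀ x)
      obtain ⟨m, hm⟩ := geometric_hahn_banach_open_point (convex_convexHull ℝ _).interior
        isOpen_interior fun hcon => lt_irrefl _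
          ((H.lt_clampedEnvelope_iff hh hxc hc).2 (interior_subset hcon))
      refine ⟨m, fun a ha hxa => ?_⟩
      by_contra! hcon
      rw [H.lt_clampedEnvelope_iff hh (subset_closure (hsph a ha)) hc] at hcon
      exact absurd (hm a (H.inter_convexHull_subset_interior (sep_subset _ _) hopen
        ⟨hsph a ha, hcon⟩)) (not_lt.2 hxa)
  exact (hausdorffMeasure_sphere_half_le m x r).trans
    (measure_mono fun a ha => ⟨ha.1, hm a ha.1 ha.2⟩)

theorem hasLocalMedianValueProperty (hc₀ : ∃ p ∈ frontier Ω, h p < c₀)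
    (hc₀' : ∃ p ∈ frontier Ω, c₀ < h p) :
    HasLocalMedianValueProperty Ω (clampedEnvelope Ω h c₀) := by
  obtain ⟨κ, hκ0, hκ, hle⟩ := H.exists_radius_factor hh hc₀
  obtain ⟨κ', hκ0', hκ', hge⟩ := H.exists_radius_factor hh.neg (c₀ := -c₀) (by simpa using hc₀')
  have hpos : ∀ x ∈ Ω, 0 < Metric.infDist x (frontier Ω) := fun x hx =>
    (isClosed_frontier.notMem_iff_infDist_pos (hc₀.imp fun _ => And.left)).1
      fun hcon => H.notMem_of_mem_frontier hcon hx
  refine ⟨fun x => min κ κ' * Metric.infDist x (frontier Ω),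
    (continuous_const.mul (Metric.continuous_infDist_pt _)).continuousOn,
    fun x hx => ⟨mul_pos (lt_min hκ0 hκ0') (hpos x hx), ?_⟩, fun x hx r hr hrx => ⟨?_, ?_⟩⟩
  · have := hpos x hx
    have : min κ κ' ≤ 1 := (min_le_left _ _).trans (hκ.trans (by norm_num))
    nlinarith
  · have hr' : r ≤ κ' * Metric.infDist x (frontier Ω) :=
      hrx.trans (mul_le_mul_of_nonneg_right (min_le_right _ _) Metric.infDist_nonneg)
    have hsub : Metric.closedBall x r ⊆ Ω := by
      refine Metric.closedBall_subset_of_lt_infDist_frontier hx (hr'.trans_lt ?_)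
      have := hpos x hx
      nlinarith
    refine (hge x hx r hr hr').trans (measure_mono fun a ha => ⟨ha.1, ?_⟩)
    have := ha.2
    rwa [H.clampedEnvelope_neg hh (subset_closure hx), H.clampedEnvelope_neg hh
      (subset_closure (hsub (Metric.sphere_subset_closedBall ha.1))), neg_le_neg_iff] at this
  · exact hle x hx r hr
      (hrx.trans (mul_le_mul_of_nonneg_right (min_le_left _ _) Metric.infDist_nonneg))

end StrictlyConvexDomain

/-! ### Components of level sets. -/

/-- The endpoints of the level set of `h` on the boundary of `Ω`. -/
def levelEndpoints (Ω : Set Plane) (h : Plane → ℝ) (c : ℝ) : Set Plane :=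
  {p ∈ frontier Ω | h p = c ∧ ∃ᶠ q in 𝓝[frontier Ω] p, h q ≠ c}

theorem levelEndpoints_neg (Ω : Set Plane) (h : Plane → ℝ) (c : ℝ) :
    levelEndpoints Ω (-h) (-c) = levelEndpoints Ω h c := by
  simp [levelEndpoints]

theorem levelEndpoints_finite {Ω : Set Plane} {h : Plane → ℝ} {c : ℝ}
    (hfin : (frontier ((fun p : frontier Ω => h p) ⁻¹' {c})).Finite) :
    (levelEndpoints Ω h c).Finite := by
  refine (hfin.image Subtype.val).subset ?_
  rintro p ⟨hp, hpc, hfreq⟩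
  refine ⟨⟨p, hp⟩, ⟨subset_closure hpc, fun hint => hfreq ?_⟩, rfl⟩
  rw [nhdsWithin_eq_map_subtype_coe hp, eventually_map]
  filter_upwards [mem_interior_iff_mem_nhds.1 hint] with q hq
  exact fun hne => hne hq

theorem notMem_interior_of_apply_le {V : Type*} [NormedAddCommGroup V] [NormedSpace ℝ V]
    {m : V →L[ℝ] ℝ} (hm : m ≠ 0) {S : Set V} {v : V} (hS : ∀ k ∈ S, m k ≤ m v) :
    v ∉ interior S := fun hv => by
  have hmax : IsLocalMax m v := Filter.eventually_of_mem (mem_interior_iff_mem_nhds.1 hv) hS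
  exact hm (by simpa using hmax.hasFDerivAt_eq_zero m.hasFDerivAt)

theorem apply_eq_of_mem_openSegment {V : Type*} [NormedAddCommGroup V] [NormedSpace ℝ V]
    {m : V →L[ℝ] ℝ} {s : ℝ} {p q v : V} (hp : m p = s) (hq : m q = s)
    (hv : v ∈ openSegment ℝ p q) : m v = s := by
  obtain ⟨a, b, -, -, hab, rfl⟩ := hv
  simp only [map_add, map_smul, smul_eq_mul, hp, hq]
  rw [← add_mul, hab, one_mul]

theorem Plane.nonempty_interior_of_apply_ne {T : Set Plane} (hT : Convex ℝ T) {p q y : Plane}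
    (hpq : openSegment ℝ p q ⊆ T) (hy : y ∈ T) (hne : detForm (q - p) y ≠ detForm (q - p) p) :
    (interior T).Nonempty := by
  -- Interior points of the chord are used because `p` and `q` need not belong to `T`.
  set a : Plane := (2 / 3 : ℝ) • p + (1 / 3 : ℝ) • q with ha
  set b : Plane := (1 / 3 : ℝ) • p + (2 / 3 : ℝ) • q with hb
  have haT : a ∈ T := hpq ⟨2 / 3, 1 / 3, by norm_num, by norm_num, by norm_num, rfl⟩
  have hbT : b ∈ T := hpq ⟨1 / 3, 2 / 3, by norm_num, by norm_num, by norm_num, rfl⟩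
  have hind : AffineIndependent ℝ ![a, b, y] := by
    rw [affineIndependent_iff_not_collinear_set, collinear_iff_of_mem (p₀ := a) (by simp)]
    rintro ⟨v, hv⟩
    obtain ⟨r, hr⟩ := hv b (by simp)
    obtain ⟨s, hs⟩ := hv y (by simp)
    refine hne ?_
    have hqp : q - p = (3 * r) • v := by
      have : b - a = r • v := by rw [hr]; simp
      rw [mul_smul, ← this, ha, hb]; module
    have hya : detForm (q - p) a = detForm (q - p) p := by
      rw [ha]; simp; ring
    rw [← hya, hs, hqp]
    simp
    ring
  have htop := hind.affineSpan_eq_top_iff_card_eq_finrank_add_one.2 (by simp)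
  refine (interior_convexHull_nonempty_iff_affineSpan_eq_top.2 htop).mono
    (interior_mono (convexHull_min ?_ hT))
  rintro _ ⟨i, rfl⟩
  fin_cases i <;> assumption

namespace StrictlyConvexDomain

variable {Ω : Set Plane} (H : StrictlyConvexDomain Ω)
include H

/-- If `T` has no interior, it lies on the line of one boundary chord; this line meets `∂Ω` only
twice, so `T` is that chord. Otherwise the boundary chords are the edges, finite in number because
their ends lie in `D`. -/
theorem isOpenChord_or_isGeneralizedPolygon {T D : Set Plane} (hTΩ : T ⊆ Ω)
    (hcl : Ω ∩ closure T ⊆ T) (hconv : Convex ℝ T) (hne : T.Nonempty) (hproper : ∃ y ∈ Ω, y ∉ T)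
    (hDf : D.Finite) (hD : D ⊆ frontier Ω)
    (hchord : ∀ y ∈ T, y ∉ interior T → ∃ p ∈ D, ∃ q ∈ D, p ≠ q ∧ y ∈ openSegment ℝ p q ∧
      openSegment ℝ p q ⊆ T \ interior T) :
    IsOpenChord Ω T ∨ IsGeneralizedPolygon Ω T := by
  obtain ⟨x, hx⟩ := hne
  obtain ⟨y, hyΩ, hy⟩ := hproper
  obtain ⟨w, hwΩ, hw⟩ := H.convex.isPreconnected.exists_mem_frontier (hTΩ hx) hx hyΩ hy
  have hwT : w ∈ T := hcl ⟨hwΩ, hw.1⟩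
  obtain ⟨p, hp, q, hq, hpq, hwpq, hsub⟩ := hchord w hwT hw.2
  by_cases hint : (interior T).Nonempty
  · refine Or.inr ⟨hTΩ, hcl, hconv, hint, {e | ∃ p ∈ D, ∃ q ∈ D, p ≠ q ∧ e = openSegment ℝ p q ∧
      openSegment ℝ p q ⊆ T \ interior T}, ?_, ⟨_, p, hp, q, hq, hpq, rfl, hsub⟩, ?_, ?_⟩
    · refine (hDf.image2 (openSegment ℝ) hDf).subset ?_
      rintro _ ⟨p, hp, q, hq, -, rfl, -⟩
      exact ⟨p, hp, q, hq, rfl⟩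
    · rintro _ ⟨p, hp, q, hq, hpq, rfl, -⟩
      exact ⟨p, hD hp, q, hD hq, hpq, rfl⟩
    · ext v
      constructor
      · rintro ⟨hvΩ, hv⟩
        obtain ⟨p, hp, q, hq, hpq, hvpq, hsub⟩ := hchord v (hcl ⟨hvΩ, hv.1⟩) hv.2
        exact ⟨_, ⟨p, hp, q, hq, hpq, rfl, hsub⟩, hvpq⟩
      · rintro ⟨_, ⟨p, hp, q, hq, hpq, rfl, hsub⟩, hvpq⟩
        exact ⟨hTΩ (hsub hvpq).1, subset_closure (hsub hvpq).1, (hsub hvpq).2⟩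
  · refine Or.inl ⟨p, hD hp, q, hD hq, hpq, subset_antisymm (fun v hv => ?_)
      (hsub.trans sdiff_subset)⟩
    have hline : ∀ k ∈ T, detForm (q - p) k = detForm (q - p) p := by
      by_contra! hcon
      obtain ⟨k, hk, hkne⟩ := hcon
      exact hint (Plane.nonempty_interior_of_apply_ne hconv (hsub.trans sdiff_subset) hk hkne)
    have hm0 : detForm (q - p) ≠ 0 := by
      intro h0
      have h1 := DFunLike.congr_fun h0 (EuclideanSpace.single 0 1)
      have h2 := DFunLike.congr_fun h0 (EuclideanSpace.single 1 1)
      simp at h1 h2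
      exact hpq (by ext i; fin_cases i <;> simp <;> linarith)
    obtain ⟨p', hp', q', hq', hpq', hvpq, hsub'⟩ := hchord v hv
      fun h => hint ⟨v, h⟩
    have hcl' : ∀ k ∈ closure (openSegment ℝ p' q'),
        detForm (q - p) k = detForm (q - p) p := fun k hk =>
      closure_minimal (fun z hz => hline z (hsub' hz).1)
        (isClosed_eq (detForm (q - p)).continuous continuous_const) hk
    rw [closure_openSegment] at hcl'
    have hw' := hline w hwT
    obtain ⟨a, ha, b, hb, -, -, -, -, huniq⟩ := H.exists_chord hwΩ hm0 subset_rfl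
      (H.mem_convexHull_slice (subset_closure hwΩ) _)
    have hmq : detForm (q - p) q = detForm (q - p) p := by simp; ring
    have hpu := huniq p (hD hp) hw'.symm
    have hqu := huniq q (hD hq) (hmq.trans hw'.symm)
    have hp'u := huniq p' (hD hp') ((hcl' p' (left_mem_segment ℝ _ _)).trans hw'.symm)
    have hq'u := huniq q' (hD hq') ((hcl' q' (right_mem_segment ℝ _ _)).trans hw'.symm)
    have : (p' = p ∧ q' = q) ∨ (p' = q ∧ q' = p) := by grind
    rcases this with ⟨rfl, rfl⟩ | ⟨rfl, rfl⟩
    · exact hvpq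
    · rwa [openSegment_symm]

variable {h : Plane → ℝ} (hh : Continuous h) {c : ℝ}
include hh

/-- The boundary in `Ω` of the convex hull of a sublevel set consists of chords between endpoints
of the level set. -/
theorem exists_levelEndpoints_chord (hc : ∃ p ∈ frontier Ω, h p < c) {y : Plane} (hy : y ∈ Ω)
    (hyc : y ∈ convexHull ℝ {p ∈ frontier Ω | h p ≤ c})
    (hyi : y ∉ interior (convexHull ℝ {p ∈ frontier Ω | h p ≤ c})) :
    ∃ m : Plane →L[ℝ] ℝ, m ≠ 0 ∧ (∀ k ∈ frontier Ω, h k ≤ c → m k ≤ m y) ∧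
      ∃ p ∈ levelEndpoints Ω h c, ∃ q ∈ levelEndpoints Ω h c, p ≠ q ∧ m p = m y ∧ m q = m y ∧
        y ∈ openSegment ℝ p q ∧ (∀ x ∈ frontier Ω, m x = m y → x = p ∨ x = q) ∧
        ∀ v ∈ openSegment ℝ p q, v ∉ interior (convexHull ℝ {p ∈ frontier Ω | h p ≤ c}) := by
  have hint := H.nonempty_interior_sublevel hh hc le_rfl
  obtain ⟨m, hm⟩ := geometric_hahn_banach_open_point (convex_convexHull ℝ _).interior
    isOpen_interior hyi
  obtain ⟨z, hz⟩ := hint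
  have hm0 : m ≠ 0 := by rintro rfl; simpa using hm z hz
  have hle : ∀ k ∈ convexHull ℝ {p ∈ frontier Ω | h p ≤ c}, m k ≤ m y := fun k hk =>
    closure_minimal (fun z hz => (hm z hz).le) (isClosed_le m.continuous continuous_const)
      (((convex_convexHull ℝ _).closure_interior_eq_closure_of_nonempty_interior ⟨z, hz⟩).symm ▸
        subset_closure hk)
  have hle' : ∀ k ∈ {p ∈ frontier Ω | h p ≤ c}, m k ≤ m y := fun k hk =>
    hle k (subset_convexHull ℝ _ hk)
  obtain ⟨p, hp, q, hq, hpq, hpy, hqy, hypq, huniq⟩ := H.exists_chord hy hm0 (sep_subset _ _)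
    (mem_convexHull_inter_of_le hle' hyc)
  -- The supporting line crosses `∂Ω` at `x`, and `h > c` on the boundary beyond it. Continuity then
  -- forces `h x = c`.
  have hend : ∀ x ∈ {p ∈ frontier Ω | h p ≤ c}, m x = m y → x ∈ levelEndpoints Ω h c := by
    rintro x ⟨hx, hxc⟩ hxy
    have hfreq : ∃ᶠ q in 𝓝[frontier Ω] x, c < h q := by
      refine ((H.frequently_apply_gt hy hx hm0 hxy).and_eventually self_mem_nhdsWithin).mono ?_
      rintro q ⟨hq, hqΩ⟩
      by_contra! hcon
      exact absurd (hle' q ⟨hqΩ, hcon⟩) (not_le.2 hq)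
    refine ⟨hx, le_antisymm hxc ?_, hfreq.mono fun q hq => hq.ne'⟩
    by_contra! hcon
    refine hfreq (mem_nhdsWithin_of_mem_nhds ?_)
    filter_upwards [(isOpen_lt hh continuous_const).mem_nhds hcon] with q hq
    exact not_lt.2 (le_of_lt hq)
  exact ⟨m, hm0, fun k hk hkc => hle' k ⟨hk, hkc⟩, p, hend p hp hpy, q, hend q hq hqy, hpq, hpy,
    hqy, hypq, huniq, fun v hv hvi =>
      absurd (hm v hvi) (by rw [apply_eq_of_mem_openSegment hpy hqy hv]; exact lt_irrefl _)⟩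

/-- The level set of the clamped envelope at the clamping level. -/
theorem middle_level (hc : ∃ p ∈ frontier Ω, h p < c) (hc' : ∃ p ∈ frontier Ω, c < h p)
    (hfin : (levelEndpoints Ω h c).Finite)
    (hne : (Ω ∩ (convexHull ℝ {p ∈ frontier Ω | h p ≤ c} ∩
      convexHull ℝ {p ∈ frontier Ω | c ≤ h p})).Nonempty) :
    IsOpenChord Ω (Ω ∩ (convexHull ℝ {p ∈ frontier Ω | h p ≤ c} ∩
      convexHull ℝ {p ∈ frontier Ω | c ≤ h p})) ∨
    IsGeneralizedPolygon Ω (Ω ∩ (convexHull ℝ {p ∈ frontier Ω | h p ≤ c} ∩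
      convexHull ℝ {p ∈ frontier Ω | c ≤ h p})) := by
  set K := convexHull ℝ {p ∈ frontier Ω | h p ≤ c} with hK
  set L := convexHull ℝ {p ∈ frontier Ω | c ≤ h p} with hL
  have hKc : IsClosed K := H.isClosed_convexHull (sep_subset _ _) (isClosed_sublevel hh c)
  have hLc : IsClosed L := H.isClosed_convexHull (sep_subset _ _)
    (isClosed_frontier.inter (isClosed_le continuous_const hh))
  have hseg : ∀ p ∈ levelEndpoints Ω h c, ∀ q ∈ levelEndpoints Ω h c, p ≠ q →
      openSegment ℝ p q ⊆ Ω ∩ (K ∩ L) := by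
    rintro p ⟨hp, hpc, -⟩ q ⟨hq, hqc, -⟩ hpq
    refine subset_inter (H.openSegment_subset (frontier_subset_closure hp)
      (frontier_subset_closure hq) hpq) (subset_inter ?_ ?_)
    · exact (convex_convexHull ℝ _).openSegment_subset (subset_convexHull ℝ _ ⟨hp, hpc.le⟩)
        (subset_convexHull ℝ _ ⟨hq, hqc.le⟩)
    · exact (convex_convexHull ℝ _).openSegment_subset (subset_convexHull ℝ _ ⟨hp, hpc.ge⟩)
        (subset_convexHull ℝ _ ⟨hq, hqc.ge⟩)
  refine H.isOpenChord_or_isGeneralizedPolygon inter_subset_left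
    (fun v hv => ⟨hv.1, closure_minimal inter_subset_right (hKc.inter hLc) hv.2⟩)
    (H.convex.inter ((convex_convexHull ℝ _).inter (convex_convexHull ℝ _))) hne ?_ hfin
    (sep_subset _ _) ?_
  · obtain ⟨p, hp, hpc⟩ := hc'
    have hpK : p ∈ Kᶜ := fun hcon =>
      absurd (H.mem_of_mem_convexHull hp (sep_subset _ _) hcon).2 (not_le.2 hpc)
    obtain ⟨y, hyK, hy⟩ := mem_closure_iff.1 (frontier_subset_closure hp) _ hKc.isOpen_compl hpK
    exact ⟨y, hy, fun hcon => hyK hcon.2.1⟩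
  · rintro y ⟨hy, hyK, hyL⟩ hyi
    rw [interior_inter, interior_inter, H.isOpen.interior_eq] at hyi
    -- A boundary point of `K ∩ L` in `Ω` is one of `K` or of `L`. Either way the entire chord lies
    -- in both hulls, since `h = c` at its ends.
    by_cases hyKi : y ∈ interior K
    · have hyLi : y ∉ interior L := fun hyLi => hyi ⟨hy, hyKi, hyLi⟩
      have e : L = convexHull ℝ {p ∈ frontier Ω | (-h) p ≤ -c} := by simp [hL]
      rw [e] at hyL hyLi
      obtain ⟨-, -, -, p, hp, q, hq, hpq, -, -, hypq, -, hi⟩ :=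
        H.exists_levelEndpoints_chord hh.neg (by simpa using hc') hy hyL hyLi
      rw [levelEndpoints_neg] at hp hq
      refine ⟨p, hp, q, hq, hpq, hypq, fun v hv => ⟨hseg p hp q hq hpq hv, fun hvi => hi v hv ?_⟩⟩
      rw [← e]
      exact interior_mono (inter_subset_right.trans inter_subset_right) hvi
    · obtain ⟨-, -, -, p, hp, q, hq, hpq, -, -, hypq, -, hi⟩ :=
        H.exists_levelEndpoints_chord hh hc hy hyK hyKi
      exact ⟨p, hp, q, hq, hpq, hypq, fun v hv => ⟨hseg p hp q hq hpq hv, fun hvi => hi v hv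
        (interior_mono (inter_subset_right.trans inter_subset_left) hvi)⟩⟩

/-- A point outside the convex hull of a strict sublevel set is cut off from it by a chord joining
endpoints of the level set. -/
theorem exists_separating_chord (hc : ∃ p ∈ frontier Ω, h p < c) {x : Plane} (hx : x ∈ Ω)
    (hxc : x ∉ convexHull ℝ {p ∈ frontier Ω | h p < c}) :
    ∃ (m : Plane →L[ℝ] ℝ) (s : ℝ), m ≠ 0 ∧ s ≤ m x ∧
      (∀ k ∈ interior (convexHull ℝ {p ∈ frontier Ω | h p < c}), m k < s) ∧
      ∃ p ∈ levelEndpoints Ω h c, ∃ q ∈ levelEndpoints Ω h c, m p = s ∧ m q = s ∧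
        p ∈ closure {p ∈ frontier Ω | h p < c} ∧ q ∈ closure {p ∈ frontier Ω | h p < c} ∧
        ∀ k ∈ frontier Ω, m k = s → k = p ∨ k = q := by
  set G := {p ∈ frontier Ω | h p < c} with hG
  have hGo := strictSublevel_mem_nhdsWithin (Ω := Ω) hh c
  have hGΩ : G ⊆ frontier Ω := sep_subset _ _
  have hcG : closure G ⊆ frontier Ω := closure_minimal hGΩ isClosed_frontier
  set I := interior (convexHull ℝ G)
  obtain ⟨z, hz⟩ := H.nonempty_interior_convexHull hGΩ hGo hc
  have hzΩ : z ∈ Ω := by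
    rw [← H.interior_closure]
    exact interior_mono (H.convexHull_subset hGΩ) hz
  -- The supporting line at a point `w` where the segment from `z` to `x` meets the boundary of the
  -- hull has `x` on its far side, because `m z < m w`.
  obtain ⟨w, hwzx, hw⟩ := (convex_segment z x).isPreconnected.exists_mem_frontier
    (left_mem_segment ℝ z x) hz (right_mem_segment ℝ z x) fun hxI => hxc (interior_subset hxI)
  have hwΩ : w ∈ Ω := H.convex.segment_subset hzΩ hx hwzx
  obtain ⟨m, hm⟩ := geometric_hahn_banach_open_point (convex_convexHull ℝ G).interior
    isOpen_interior (by rw [isOpen_interior.frontier_eq] at hw; exact hw.2)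
  have hm0 : m ≠ 0 := by rintro rfl; simpa using hm z hz
  have hle : ∀ k ∈ closure G, m k ≤ m w := by
    refine fun k hk => closure_minimal (fun k hk => ?_)
      (isClosed_le m.continuous continuous_const) hk
    exact closure_minimal (fun z hz => (hm z hz).le) (isClosed_le m.continuous continuous_const)
      (H.subset_closure_interior_convexHull hGΩ hGo (subset_convexHull ℝ _ hk))
  have hwG : w ∈ convexHull ℝ (closure G) :=
    closure_minimal (interior_subset.trans (convexHull_mono subset_closure))
      (H.isClosed_convexHull hcG isClosed_closure) hw.1
  obtain ⟨p, hp, q, hq, -, hpw, hqw, -, huniq⟩ := H.exists_chord hwΩ hm0 hcG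
    (mem_convexHull_inter_of_le hle hwG)
  have hend : ∀ k ∈ closure G, m k = m w → k ∈ levelEndpoints Ω h c := by
    intro k hk hkw
    have hkc : h k ≤ c := closure_minimal (fun z hz => le_of_lt hz.2)
      (isClosed_le hh continuous_const) hk
    refine ⟨hcG hk, le_antisymm hkc ?_, ?_⟩
    · by_contra! hcon
      exact H.apply_ne_of_isMaxOn hGΩ hGo hwΩ hm0 (fun q hq => hle q (subset_closure hq))
        ⟨hcG hk, hcon⟩ hkw
    · rw [frequently_nhdsWithin_iff]
      exact (mem_closure_iff_frequently.1 hk).mono fun q hq => ⟨hq.2.ne, hq.1⟩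
  refine ⟨m, m w, hm0, ?_, hm, p, hend p hp hpw, q, hend q hq hqw, hpw, hqw, hp, hq, huniq⟩
  obtain ⟨a, b, ha, hb, hab, rfl⟩ := hwzx
  by_contra! hcon
  have h1 := hm z hz
  obtain rfl : a = 1 - b := by linarith
  simp only [map_add, map_smul, smul_eq_mul] at h1 hcon
  rcases le_total (m x) (m z) with hxz | hxz
  · linarith [mul_le_mul_of_nonneg_left hxz hb]
  · linarith [mul_le_mul_of_nonneg_left hxz ha]

/-- The components of the level sets of the clamped envelope above the clamping level. -/
theorem upper_level (hc : ∃ p ∈ frontier Ω, h p < c) (hfin : (levelEndpoints Ω h c).Finite)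
    {W : Set Plane} (hW : W = {y ∈ Ω | y ∈ convexHull ℝ {p ∈ frontier Ω | h p ≤ c} ∧
      y ∉ convexHull ℝ {p ∈ frontier Ω | h p < c}}) {x : Plane} (hx : x ∈ W) :
    IsOpenChord Ω (connectedComponentIn W x) ∨
    IsGeneralizedPolygon Ω (connectedComponentIn W x) := by
  obtain ⟨hxΩ, hxK, hxG⟩ : x ∈ Ω ∧ x ∈ convexHull ℝ {p ∈ frontier Ω | h p ≤ c} ∧
    x ∉ convexHull ℝ {p ∈ frontier Ω | h p < c} := by rwa [hW] at hx
  obtain ⟨m, s, hm0, hsx, hm, p, hp, q, hq, hps, hqs, hpG, hqG, huniq⟩ :=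
    H.exists_separating_chord hh hc hxΩ hxG
  have hGo := strictSublevel_mem_nhdsWithin (Ω := Ω) hh c
  have hIsub := H.inter_convexHull_subset_interior (sep_subset _ _) hGo
  have hGI := H.subset_closure_interior_convexHull (sep_subset _ _) hGo
  obtain ⟨z, hz⟩ := H.nonempty_interior_convexHull (sep_subset _ _) hGo hc
  set G := {p ∈ frontier Ω | h p < c} with hG
  set K := convexHull ℝ {p ∈ frontier Ω | h p ≤ c} with hK
  set I := interior (convexHull ℝ G) with hI
  have hzΩ : z ∈ Ω := by
    rw [← H.interior_closure]
    exact interior_mono (H.convexHull_subset (sep_subset _ _)) hz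
  have hzs := hm z hz
  have hKc : IsClosed K := H.isClosed_convexHull (sep_subset _ _) (isClosed_sublevel hh c)
  have hpI : p ∈ closure I :=
    closure_minimal ((subset_convexHull ℝ _).trans hGI) isClosed_closure hpG
  have hqI : q ∈ closure I :=
    closure_minimal ((subset_convexHull ℝ _).trans hGI) isClosed_closure hqG
  have hline : ∀ y ∈ Ω, m y = s → y ∈ convexHull ℝ {p, q} := by
    intro y hy hys
    refine convexHull_mono ?_ (H.mem_convexHull_slice (subset_closure hy) m)
    rintro k ⟨hk, hky⟩
    exact huniq k hk (hky.trans hys)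
  -- Near a point of the separating chord, every point on the near side is in `I`: its radial
  -- projection `f v` from `z` lands on the chord, which lies in `closure I`, and `z` is interior.
  have hnhds : ∀ y ∈ Ω, m y = s → ∀ᶠ v in 𝓝 y, v ∈ I ∨ s ≤ m v := by
    intro y hy hys
    have hyz : m y - m z ≠ 0 := by rw [hys]; linarith
    set f : Plane → Plane := fun v => z + ((s - m z) / (m v - m z)) • (v - z) with hf
    have hfc : ContinuousAt f y := by
      have hq : ContinuousAt (fun v => (s - m z) / (m v - m z)) y :=
        continuousAt_const.div (by fun_prop) hyz
      exact continuousAt_const.add (hq.smul (by fun_prop))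
    have hfy : f y = y := by
      rw [hf]; simp only [hys]
      rw [div_self (by linarith)]; simp
    have h1 : ∀ᶠ v in 𝓝 y, f v ∈ Ω := hfc.eventually_mem (by
      rw [hfy]; exact H.isOpen.mem_nhds hy)
    have h2 : ∀ᶠ v in 𝓝 y, m z < m v :=
      m.continuous.continuousAt.eventually_const_lt (by rw [hys]; exact hzs)
    filter_upwards [h1, h2] with v hv1 hv2
    refine or_iff_not_imp_right.2 fun hvs => ?_
    rw [not_le] at hvs
    have hpos : 0 < m v - m z := by linarith
    have hmf : m (f v) = s := by
      simp only [hf, map_add, map_smul, map_sub, smul_eq_mul]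
      field_simp; ring
    have hfI : f v ∈ closure I := by
      refine convexHull_min ?_ (convex_convexHull ℝ G).interior.closure (hline _ hv1 hmf)
      rintro _ (rfl | rfl) <;> assumption
    have hIc : Convex ℝ I := (convex_convexHull ℝ G).interior
    have hop := hIc.openSegment_interior_closure_subset_interior
      (by rw [hI, interior_interior]; exact hz) hfI
    rw [hI, interior_interior] at hop
    refine hop ⟨1 - (m v - m z) / (s - m z), (m v - m z) / (s - m z), ?_, ?_, by ring, ?_⟩
    · rw [sub_pos, div_lt_one (by linarith)]; linarith
    · exact div_pos hpos (by linarith)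
    · have hsz : s - m z ≠ 0 := by linarith
      have e : (m v - m z) / (s - m z) * ((s - m z) / (m v - m z)) = 1 := by
        field_simp
      rw [hf]
      calc _ = z + ((m v - m z) / (s - m z) * ((s - m z) / (m v - m z))) • (v - z) := by module
        _ = v := by rw [e]; simp
  have hTW : Ω ∩ (K ∩ {y | s ≤ m y}) ⊆ W := by
    rintro y ⟨hy, hyK, hys⟩
    have hys : s ≤ m y := hys
    rw [hW]
    exact ⟨hy, hyK, fun hyG => absurd (hm y (hIsub ⟨hy, hyG⟩)) (not_lt.2 hys)⟩
  have hTc : Convex ℝ (Ω ∩ (K ∩ {y | s ≤ m y})) :=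
    H.convex.inter ((convex_convexHull ℝ _).inter
      (convex_halfSpace_ge m.toLinearMap.isLinear s))
  have hcomp : connectedComponentIn W x = Ω ∩ (K ∩ {y | s ≤ m y}) := by
    refine subset_antisymm (fun y hy => ?_)
      (hTc.isPreconnected.subset_connectedComponentIn ⟨hxΩ, hxK, hsx⟩ hTW)
    have hyW := connectedComponentIn_subset W x hy
    rw [hW] at hyW
    refine ⟨hyW.1, hyW.2.1, ?_⟩
    change s ≤ m y
    by_contra! hys
    -- By `hnhds`, the near and far sides of the line cut `W` into relatively open pieces, so a
    -- component cannot cross it.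
    have hO2 : ∀ v ∈ W, s ≤ m v → v ∈ interior (I ∪ {v | s ≤ m v}) := by
      intro v hv hsv
      rw [hW] at hv
      rw [mem_interior_iff_mem_nhds]
      rcases hsv.eq_or_lt with h1 | h1
      · exact hnhds v hv.1 h1.symm
      · filter_upwards [m.continuous.continuousAt.eventually_const_lt h1] with k hk
        exact Or.inr hk.le
    obtain ⟨v, hvS, hv1, hv2⟩ := isPreconnected_connectedComponentIn (F := W) (x := x)
      {v | m v < s} (interior (I ∪ {v | s ≤ m v})) (isOpen_lt m.continuous continuous_const)
      isOpen_interior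
      (fun v hv => (lt_or_ge (m v) s).imp id (hO2 v (connectedComponentIn_subset W x hv)))
      ⟨y, hy, hys⟩ ⟨x, mem_connectedComponentIn hx, hO2 x hx hsx⟩
    have hv1 : m v < s := hv1
    have hvW := connectedComponentIn_subset W x hvS
    rw [hW] at hvW
    rcases interior_subset hv2 with h1 | h1
    · exact hvW.2.2 (interior_subset h1)
    · exact absurd hv1 (not_lt.2 h1)
  rw [hcomp]
  refine H.isOpenChord_or_isGeneralizedPolygon inter_subset_left
    (fun v hv => ⟨hv.1, closure_minimal inter_subset_right
      (hKc.inter (isClosed_le continuous_const m.continuous)) hv.2⟩) hTc ⟨x, hxΩ, hxK, hsx⟩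
    ⟨z, hzΩ, fun hcon => absurd hzs (not_lt.2 hcon.2.2)⟩ hfin (sep_subset _ _) ?_
  have hseg : ∀ a ∈ levelEndpoints Ω h c, ∀ b ∈ levelEndpoints Ω h c, a ≠ b → s ≤ m a → s ≤ m b →
      openSegment ℝ a b ⊆ Ω ∩ (K ∩ {y | s ≤ m y}) := by
    rintro a ⟨ha, hac, -⟩ b ⟨hb, hbc, -⟩ hab hsa hsb
    refine subset_inter (H.openSegment_subset (frontier_subset_closure ha)
      (frontier_subset_closure hb) hab) (subset_inter ?_ ?_)
    · exact (convex_convexHull ℝ _).openSegment_subset (subset_convexHull ℝ _ ⟨ha, hac.le⟩)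
        (subset_convexHull ℝ _ ⟨hb, hbc.le⟩)
    · exact (convex_halfSpace_ge m.toLinearMap.isLinear s).openSegment_subset hsa hsb
  rintro y ⟨hy, hyK, hys⟩ hyi
  have hys : s ≤ m y := hys
  rcases hys.eq_or_lt with hys | hys
  · obtain ⟨a, ha, b, hb, hab, hay, hby, hyab, -⟩ := H.exists_chord hy hm0 subset_rfl
      (H.mem_convexHull_slice (subset_closure hy) m)
    have hend : ∀ k ∈ frontier Ω, m k = m y → k ∈ levelEndpoints Ω h c := by
      intro k hk hky
      rcases huniq k hk (hky.trans hys.symm) with rfl | rfl <;> assumption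
    refine ⟨a, hend a ha hay, b, hend b hb hby, hab, hyab, fun v hv =>
      ⟨hseg a (hend a ha hay) b (hend b hb hby) hab (by rw [hay, hys]) (by rw [hby, hys]) hv, ?_⟩⟩
    refine notMem_interior_of_apply_le (neg_ne_zero.2 hm0) fun k hk => ?_
    have hks : s ≤ m k := hk.2.2
    rw [neg_apply, neg_apply, apply_eq_of_mem_openSegment hay hby hv]
    linarith
  · have hyKi : y ∉ interior K := fun hcon => hyi (by
      rw [mem_interior_iff_mem_nhds]
      filter_upwards [H.isOpen.mem_nhds hy, mem_interior_iff_mem_nhds.1 hcon,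
        m.continuous.continuousAt.eventually_const_lt hys] with k h1 h2 h3
      exact ⟨h1, h2, h3.le⟩)
    obtain ⟨m', hm0', hle', a, ha, b, hb, hab, hay, hby, hyab, huniq', hi⟩ :=
      H.exists_levelEndpoints_chord hh hc hy hyK hyKi
    -- If a chord end `k` were on the near side, the chord would meet the line `m = s` at some `v ∈
    -- Ω` in the hull of `{p, q}`. The line `m' = m' y` supports `K`, so its boundary points are
    -- found among `p, q`; then `k` is `p` or `q`, against `m k < s`.
    have hside : ∀ k ∈ frontier Ω, m' k = m' y → (k = a ∨ k = b) → s ≤ m k := by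
      intro k hk hky hkab
      by_contra! hks
      have hpos : 0 < m y - m k := by linarith
      obtain ⟨t, ht⟩ : ∃ t, t = (s - m k) / (m y - m k) := ⟨_, rfl⟩
      have ht0 : 0 < t := by rw [ht]; exact div_pos (by linarith) hpos
      have ht1 : t < 1 := by rw [ht, div_lt_one hpos]; linarith
      have hv : (1 - t) • k + t • y ∈ openSegment ℝ k y :=
        ⟨1 - t, t, by linarith, ht0, by ring, rfl⟩
      set v := (1 - t) • k + t • y with hvdef
      have hvΩ : v ∈ Ω := H.openSegment_subset_of_mem hy (frontier_subset_closure hk)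
        (by rwa [openSegment_symm])
      have hvs : m v = s := by
        rw [hvdef, ht]; simp only [map_add, map_smul, smul_eq_mul]; field_simp; ring
      have hv' : m' v = m' y := apply_eq_of_mem_openSegment hky rfl hv
      have hpqΩ : ({p, q} : Set Plane) ⊆ frontier Ω := by
        rintro _ (rfl | rfl)
        exacts [hp.1, hq.1]
      have hface := mem_convexHull_inter_of_le (m := m') (fun e he => by
        rw [hv']
        rcases he with rfl | rfl
        exacts [hle' _ hp.1 hp.2.1.le, hle' _ hq.1 hq.2.1.le]) (hline v hvΩ hvs)
      obtain ⟨p', hp', q', hq', hpq', hp'v, hq'v, -, -⟩ := H.exists_chord hvΩ hm0' hpqΩ hface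
      have h1 := huniq' p' (hpqΩ hp') (hp'v.trans hv')
      have h2 := huniq' q' (hpqΩ hq') (hq'v.trans hv')
      have h3 : k = p' ∨ k = q' := by grind
      have h4 : k = p ∨ k = q := by
        rcases h3 with rfl | rfl
        exacts [hp', hq']
      rcases h4 with rfl | rfl <;> linarith
    refine ⟨a, ha, b, hb, hab, hyab, fun v hv => ⟨hseg a ha b hb hab
      (hside a ha.1 hay (Or.inl rfl)) (hside b hb.1 hby (Or.inr rfl)) hv, fun hvi => hi v hv ?_⟩⟩
    exact interior_mono (inter_subset_right.trans inter_subset_left) hvi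

end StrictlyConvexDomain

/-! ### The main theorem. -/

theorem theorem2 (Ω : Set (EuclideanSpace ℝ (Fin 2)))
    (hΩ_open : IsOpen Ω) (hΩ_bdd : Bornology.IsBounded Ω)
    (hΩ_convex : Convex ℝ Ω) (hΩ_strict : StrictConvex ℝ (closure Ω))
    (g : frontier Ω → ℝ) (hg : Continuous g) (hg_nonconst : ∃ x y, g x ≠ g y)
    (hg_level : ∀ c : ℝ, (frontier (g ⁻¹' {c})).Finite) :
    ∃ u : EuclideanSpace ℝ (Fin 2) → ℝ,
      ContinuousOn u (closure Ω) ∧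
      HasLocalMedianValueProperty Ω u ∧
      (∀ x : frontier Ω, u x = g x) ∧
      -- every component of every level set of `u` in `Ω` is a chord or a generalized polygon
      ∀ c : ℝ, ∀ x ∈ {y ∈ Ω | u y = c},
        IsOpenChord Ω (connectedComponentIn {y ∈ Ω | u y = c} x) ∨
        IsGeneralizedPolygon Ω (connectedComponentIn {y ∈ Ω | u y = c} x) := by
  -- Tietze extension: the envelopes use only the boundary values of `h`, so the choice of extension
  -- is immaterial.
  obtain ⟨⟨h, hh⟩, hres⟩ :=
    ContinuousMap.exists_restrict_eq (isClosed_frontier (s := Ω)) ⟨g, hg⟩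
  obtain rfl : (fun p : frontier Ω => h p) = g := funext fun p => DFunLike.congr_fun hres p
  have hfin : ∀ c, (levelEndpoints Ω h c).Finite := fun c => levelEndpoints_finite (hg_level c)
  obtain ⟨p, q, hpq⟩ : ∃ p q : frontier Ω, h p < h q := by
    obtain ⟨p, q, hpq⟩ := hg_nonconst
    rcases lt_or_gt_of_ne hpq with hlt | hlt
    exacts [⟨p, q, hlt⟩, ⟨q, p, hlt⟩]
  have H : StrictlyConvexDomain Ω := ⟨hΩ_open, hΩ_bdd, hΩ_convex, hΩ_strict,
    closure_nonempty_iff.1 ⟨p, frontier_subset_closure p.2⟩⟩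
  obtain ⟨c₀, hpc, hcq⟩ := exists_between hpq
  have hlow : ∃ p ∈ frontier Ω, h p < c₀ := ⟨p, p.2, hpc⟩
  have hhigh : ∃ p ∈ frontier Ω, c₀ < h p := ⟨q, q.2, hcq⟩
  refine ⟨clampedEnvelope Ω h c₀, H.continuousOn_clampedEnvelope hh,
    H.hasLocalMedianValueProperty hh hlow hhigh,
    fun x => H.clampedEnvelope_eq_of_mem_frontier hh x.2, fun c x hx => ?_⟩
  rcases lt_trichotomy c c₀ with hc | rfl | hc
  -- Below `c₀`, the upper case is applied to `-h` at level `-c`.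
  · obtain ⟨k, hk, hck⟩ := hhigh
    refine H.upper_level hh.neg (c := -c) ⟨k, hk, neg_lt_neg (hc.trans hck)⟩
      (by rw [levelEndpoints_neg]; exact hfin c) ?_ hx
    ext y
    refine and_congr_right fun hy => ?_
    have hyc := subset_closure hy
    have h1 := H.clampedEnvelope_le_iff hh.neg hyc (neg_le_neg hc.le)
    have h2 := H.clampedEnvelope_lt_iff hh.neg hyc (neg_lt_neg hc)
    rw [H.clampedEnvelope_neg hh hyc] at h1 h2
    rw [← h1, ← h2, neg_le_neg_iff, neg_lt_neg_iff, not_lt, eq_comm, le_antisymm_iff]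
  · have e : {y ∈ Ω | clampedEnvelope Ω h c y = c} =
        Ω ∩ (convexHull ℝ {p ∈ frontier Ω | h p ≤ c} ∩
          convexHull ℝ {p ∈ frontier Ω | c ≤ h p}) := by
      ext y
      refine and_congr_right fun hy => ?_
      have hyc := subset_closure hy
      rw [mem_inter_iff, ← H.clampedEnvelope_le_iff hh hyc le_rfl,
        ← H.le_clampedEnvelope_iff hh hyc le_rfl, le_antisymm_iff]
    have hx' := hx
    rw [e] at hx'
    rw [e, (H.convex.inter ((convex_convexHull ℝ _).inter
      (convex_convexHull ℝ _))).isPreconnected.connectedComponentIn hx']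
    exact H.middle_level hh hlow hhigh (hfin c) ⟨x, hx'⟩
  · obtain ⟨k, hk, hck⟩ := hlow
    refine H.upper_level hh ⟨k, hk, hck.trans hc⟩ (hfin c) ?_ hx
    ext y
    refine and_congr_right fun hy => ?_
    have hyc := subset_closure hy
    rw [← H.clampedEnvelope_le_iff hh hyc hc.le, ← H.clampedEnvelope_lt_iff hh hyc hc, not_lt,
      le_antisymm_iff]
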